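/- A domain in $\mathbb{C}^n$ is a nonempty connected open set. Write $\mathcal{O}(G)$ for the space of holomorphic functions on a domain $G\subset\mathbb{C}^n$. For a space $\mathcal{F}\subset\mathcal{O}(G)$ we say that $G$ is an $\mathcal{F}$-domain of holomorphy if there are no domains $G_0,\widetilde G\subset\mathbb{C}^n$ with $\varnothing\neq G_0\subset G\cap\widetilde G$ and $\widetilde G\not\subset G$ such that for each $f\in\mathcal{F}$ there is $\widetilde f\in\mathcal{O}(\widetilde G)$ with $\widetilde f=f$ on $G_0$. The domain $G$ is $n$-circled if $(e^{i\theta_1}z_1,\dots,e^{i\theta_n}z_n)\in G$ for all $(z_1,\dots,z_n)\in G$ and $(\theta_1,\dots,\theta_n)\in\mathbb{R}^n$. Let $\mathcal{H}^\infty(G)$ be the space of bounded holomorphic functions on $G$. Let $\mathcal{O}(\overline G)$ be the space of functions on $G$ that extend holomorphically to an open neighbourhood of $\overline G$. Put $$\mathcal{A}^k(G)=\{f\in\mathcal{O}(G):\ \text{for every } \nu\in\mathbb{Z}_{\ge0}^n \text{ with } |\nu|\le k \text{ there is } f_\nu\in\mathcal{C}(\overline G) \text{ with } f_\nu=\partial^\nu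 f \text{ in } G\},$$ $\mathcal{A}^\infty(G)=\bigcap_{k\ge0}\mathcal{A}^k(G)$, and $$\mathcal{S}(G)=\{f\in\mathcal{O}(G):\ \sup_{K\cap G}|\partial^\nu f|<+\infty \text{ for every compact } K\subset\overline G \text{ and every } \nu\in\mathbb{Z}_{\ge0}^n\}.$$ Here $\partial^\nu=\partial^{|\nu|}/\partial z_1^{\nu_1}\cdots\partial z_n^{\nu_n}$ and $|\nu|=\nu_1+\dots+\nu_n$. For $\varepsilon\in\{0,1\}^n$ put $$V_\varepsilon=\{z\in\mathbb{C}^n:\ z_j=0 \text{ for all } j \text{ with } \varepsilon_j=1,\ z_j\ne0 \text{ for all } j \text{ with } \varepsilon_j=0\},$$ $$G_\varepsilon=\{(\lambda_1^{\varepsilon_1}z_1,\dots,\lambda_n^{\varepsilon_n}z_n):\ \lambda_1,\dots,\lambda_n\in\mathbb{C},\ |\lambda_j|\le1,\ (z_1,\dots,z_n)\in G\},$$ with $0^0=1$. Proposition 5. Let $G\subset\mathbb{C}^n$ be an $n$-circled $\mathcal{H}^\infty(G)$-domain of holomorphy. Then the following conditions are equivalent: (i) for every $\varepsilon\in\{0,1\}^n$,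 if $V_\varepsilon\cap\partial G\neq\varnothing$, then $G_\varepsilon\subset G$; (ii) $G$ is an $\mathcal{S}(G)$-domain of holomorphy; (iii) $G$ is an $\mathcal{A}^\infty(G)$-domain of holomorphy; (iv) $G$ is an $\mathcal{H}^\infty(G)\cap\mathcal{O}(\overline G)$-domain of holomorphy. -/

import Mathlib

namespace Circled

/-- A domain in `ℂⁿ`: a nonempty connected open set. -/
def IsDom {n : ℕ} (G : Set (Fin n → ℂ)) : Prop :=
  IsOpen G ∧ IsConnected G

/-- `G` is `n`-circled: invariant under independent rotations of the coordinates. -/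
def IsCircled {n : ℕ} (G : Set (Fin n → ℂ)) : Prop :=
  ∀ z ∈ G, ∀ θ : Fin n → ℝ, (fun j => Complex.exp (Complex.I * (θ j : ℂ)) * z j) ∈ G

/-- `𝒪(G)`, for open `G`: the functions holomorphic on `G`. Functions are total, and only their
values on `G` matter. -/
def Hol {n : ℕ} (G : Set (Fin n → ℂ)) : Set ((Fin n → ℂ) → ℂ) :=
  {f | DifferentiableOn ℂ f G}

/-- The partial derivative `∂f/∂z_j`. -/
noncomputable def pderiv {n : ℕ} (j : Fin n) (f : (Fin n → ℂ) → ℂ) : (Fin n → ℂ) → ℂ :=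
  fun z => fderiv ℂ f z (Pi.single j 1)

/-- The iterated partial derivative `∂^ν f` for a multi-index `ν`; the derivatives in the last
variable are taken first. -/
noncomputable def mderiv {n : ℕ} (ν : Fin n → ℕ) (f : (Fin n → ℂ) → ℂ) : (Fin n → ℂ) → ℂ :=
  (List.finRange n).foldr (fun j g => (pderiv j)^[ν j] g) f

/-- `H^∞(G)`: the bounded holomorphic functions on `G`. -/
def HInf {n : ℕ} (G : Set (Fin n → ℂ)) : Set ((Fin n → ℂ) → ℂ) :=
  {f | f ∈ Hol G ∧ ∃ C : ℝ, ∀ z ∈ G, ‖f z‖ ≤ C}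

/-- `𝒜^k(G)`: the holomorphic functions on `G` all of whose derivatives of order at most `k`
extend continuously to the closure of `G`. -/
def ASpace {n : ℕ} (k : ℕ) (G : Set (Fin n → ℂ)) : Set ((Fin n → ℂ) → ℂ) :=
  {f | f ∈ Hol G ∧ ∀ ν : Fin n → ℕ, ∑ j, ν j ≤ k →
    ∃ g : (Fin n → ℂ) → ℂ, ContinuousOn g (closure G) ∧ Set.EqOn g (mderiv ν f) G}

/-- `𝒜^∞(G)`, the intersection of all the `𝒜^k(G)`. -/
def AInf {n : ℕ} (G : Set (Fin n → ℂ)) : Set ((Fin n → ℂ) → ℂ) :=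
  ⋂ k : ℕ, ASpace k G

/-- `𝒮(G)`: the holomorphic functions on `G` each derivative of which is bounded on `K ∩ G` for
every compact subset `K` of the closure of `G`. -/
def SSpace {n : ℕ} (G : Set (Fin n → ℂ)) : Set ((Fin n → ℂ) → ℂ) :=
  {f | f ∈ Hol G ∧ ∀ K : Set (Fin n → ℂ), IsCompact K → K ⊆ closure G →
    ∀ ν : Fin n → ℕ, ∃ C : ℝ, ∀ z ∈ K ∩ G, ‖mderiv ν f z‖ ≤ C}

/-- `𝒪(closure G)`, regarded as a space of functions on `G`: those which extend holomorphically to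
an open neighbourhood of the closure of `G`. -/
def HolClosure {n : ℕ} (G : Set (Fin n → ℂ)) : Set ((Fin n → ℂ) → ℂ) :=
  {f | ∃ U : Set (Fin n → ℂ), IsOpen U ∧ closure G ⊆ U ∧ ∃ F ∈ Hol U, Set.EqOn F f G}

/-- `G` is an `ℱ`-domain of holomorphy: there are no domains `G₀`, `G'` with
`G₀ ⊆ G ∩ G'` and `G' ⊄ G` such that every `f ∈ ℱ` agrees on `G₀` with a function holomorphic
on `G'`. -/
def IsDomainOfHolomorphy {n : ℕ} (ℱ : Set ((Fin n → ℂ) → ℂ)) (G : Set (Fin n → ℂ)) : Prop :=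
  ¬ ∃ G₀ G' : Set (Fin n → ℂ), IsDom G₀ ∧ IsDom G' ∧ G₀ ⊆ G ∩ G' ∧ ¬ G' ⊆ G ∧
    ∀ f ∈ ℱ, ∃ F ∈ Hol G', Set.EqOn F f G₀

/-- `V_ε`: the points whose vanishing coordinates are exactly those with `ε_j = 1`. -/
def VSet {n : ℕ} (ε : Fin n → Fin 2) : Set (Fin n → ℂ) :=
  {z | (∀ j, ε j = 1 → z j = 0) ∧ (∀ j, ε j = 0 → z j ≠ 0)}

/-- `G_ε`: the points `(l₁^ε₁ z₁, …, lₙ^εₙ zₙ)` with `z ∈ G` and all `l_j` in the closed unit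
disc. -/
def GSet {n : ℕ} (ε : Fin n → Fin 2) (G : Set (Fin n → ℂ)) : Set (Fin n → ℂ) :=
  {w | ∃ l : Fin n → ℂ, (∀ j, ‖l j‖ ≤ 1) ∧ ∃ z ∈ G, w = fun j => l j ^ (ε j : ℕ) * z j}

end Circled

/-!
The action of the torus on an `n`-circled domain `G` splits every holomorphic function `f` on `G`
into components `f_α(z) = ∫ e(-α·t) f(e(t) z) dt`. They are multiples `a_α z^α` of Laurent monomials
without poles in `G`, satisfy Cauchy's inequality `|a_α z^α| ≤ sup |f|` over the torus orbit of `z`,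
and `f = ∑ a_α z^α` on `G` (`exists_laurent`). Continuation of `f` then reduces to continuation of
its terms with bounds: if no `a_α z^α` has poles in an open set `U` and the terms are locally
uniformly bounded there, the series converges to a holomorphic function on `U`
(`summable_and_differentiableOn_tsum_mon`). Indeed, multiplying each coordinate by a suitable factor
`(1 + η)^{±1}` keeps the point in `U` and enlarges the term by `(1 + η)^|α|`, so that the terms are
dominated by a geometric series.

If the condition on the sets `G_ε` holds, then every Laurent monomial `z^α` without poles in `G` has
none in the closure of `G` (`closure_subset_monDomain`). So if it is bounded by `C` on `G`, then
`z^α` and `1 / (c - z^α)`, for `|c| > C`, belong to `H^∞(G) ∩ 𝒪(closure G)`. When all functions of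
this space continue to `G'`, the monomial therefore has no poles in `G'` and does not take the value
`c` there, that is, it is still bounded by `C` (`norm_mon_le_of_forall_extension`). Applied to the
terms of the Laurent series of a bounded function `f`, this shows that `f` continues to `G'`. Hence
an `H^∞(G)`-domain of holomorphy is an `H^∞(G) ∩ 𝒪(closure G)`-domain of holomorphy. This space is
contained in `𝒜^∞(G)`, which is contained in `𝒮(G)`.

Conversely, suppose that `V_ε` contains a boundary point `z₀`, and let `f ∈ 𝒮(G)`. The derivatives
of the components of `f` are components of derivatives of `f`, hence bounded near `z₀`. A term with a
negative exponent at some coordinate vanishing at `z₀` violates this after the positive powers of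
such coordinates have been differentiated away (`nonneg_of_mem_SSpace`). So the terms of the Laurent
series do not grow in modulus when coordinates with `ε_j = 1` shrink, and `f` continues to the domain
`G_ε` (`exists_extension_GSet`). If `G` is an `𝒮(G)`-domain of holomorphy, this forces `G_ε ⊆ G`.
-/

open Set Filter Topology MeasureTheory Metric

namespace Circled

/-! ### Holomorphic functions of several variables -/

/-- Cauchy's estimate for the total derivative. -/
theorem norm_fderiv_le_of_forall_mem_ball {E : Type*} [NormedAddCommGroup E] [NormedSpace ℂ E]
    {f : E → ℂ} {c : E} {R M : ℝ} (hR : 0 < R) (hf : DifferentiableOn ℂ f (ball c R))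
    (hM : ∀ z ∈ ball c R, ‖f z‖ ≤ M) : ‖fderiv ℂ f c‖ ≤ 2 * M / R := by
  refine Complex.norm_fderiv_le_div_of_mapsTo_ball hf (fun z hz => ?_) hR
  rw [mem_closedBall, dist_eq_norm]
  calc ‖f z - f c‖ ≤ ‖f z‖ + ‖f c‖ := norm_sub_le _ _
    _ ≤ 2 * M := by linarith [hM z hz, hM c (mem_ball_self hR)]

/-- The identity theorem: holomorphic functions on a connected open set which agree on a nonempty
open subset agree. The set of interior zeros of the difference is relatively closed, because on
complex lines the one-variable identity theorem applies. -/
theorem eqOn_of_eqOn_isOpen {E : Type*} [NormedAddCommGroup E] [NormedSpace ℂ E]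
    {f g : E → ℂ} {U V : Set E} (hU : IsOpen U) (hUc : IsPreconnected U) (hV : IsOpen V)
    (hVn : V.Nonempty) (hVU : V ⊆ U) (hf : DifferentiableOn ℂ f U) (hg : DifferentiableOn ℂ g U)
    (hfg : EqOn f g V) : EqOn f g U := by
  set Z : Set E := interior {z | f z = g z} with hZ
  have hsub : U ⊆ Z := by
    obtain ⟨v, hv⟩ := hVn
    refine hUc.subset_of_closure_inter_subset isOpen_interior
      ⟨v, hVU hv, interior_maximal (fun z hz => hfg hz) hV hv⟩ ?_
    rintro z ⟨hzc, hzU⟩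
    obtain ⟨r, hr, hrU⟩ := Metric.isOpen_iff.1 hU z hzU
    obtain ⟨w, hwZ, hwr⟩ := Metric.mem_closure_iff.1 hzc r hr
    refine interior_maximal (fun x hx => ?_) isOpen_ball (mem_ball_self hr)
    -- restrict to the complex line through `w` and `x`
    set γ : ℂ → E := fun s => w + s • (x - w) with hγ
    have hγd : Differentiable ℂ γ := by fun_prop
    set D : Set ℂ := γ ⁻¹' ball z r
    have hDo : IsOpen D := isOpen_ball.preimage hγd.continuous
    have hDc : IsPreconnected D := by
      refine Convex.isPreconnected fun s hs t ht a b ha hb hab => ?_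
      have h := convex_ball z r hs ht ha hb hab
      have hb' : b = 1 - a := by linarith
      subst hb'
      have e : γ (a • s + (1 - a) • t) = a • γ s + (1 - a) • γ t := by
        simp only [hγ, Complex.real_smul, ← Complex.coe_smul (E := E), Complex.ofReal_sub,
          Complex.ofReal_one]
        module
      rw [mem_preimage, e]
      exact h
    have hD0 : (0 : ℂ) ∈ D := by simpa [D, hγ, dist_comm] using hwr
    have hD1 : (1 : ℂ) ∈ D := by simpa [D, hγ] using hx
    have hF : ∀ F : E → ℂ, DifferentiableOn ℂ F U → AnalyticOnNhd ℂ (F ∘ γ) D := fun F hF =>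
      (hF.comp hγd.differentiableOn fun s hs => hrU hs).analyticOnNhd hDo
    have hev : f ∘ γ =ᶠ[𝓝 0] g ∘ γ := by
      have : Z ∈ 𝓝 (γ 0) := isOpen_interior.mem_nhds (by simpa [hγ] using hwZ)
      filter_upwards [hγd.continuous.continuousAt this] with s hs
      exact interior_subset (s := {z | f z = g z}) hs
    have h1 := (hF f hf).eqOn_of_preconnected_of_eventuallyEq (hF g hg) hDc hD0 hev hD1
    simpa [hγ] using h1
  exact fun z hz => interior_subset (s := {z | f z = g z}) (hsub hz)

/-- Differentiation under the integral sign for averages of a holomorphic function over affine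
images of the argument. -/
theorem hasFDerivAt_integral_comp_affine {n : ℕ} {T : Type*} [TopologicalSpace T]
    [MeasurableSpace T] [BorelSpace T] [SecondCountableTopology T]
    (μ : Measure T) [IsFiniteMeasure μ] {k : T → ℂ} {d b : T → Fin n → ℂ}
    (hk : Continuous k) (hd : Continuous d) (hb : Continuous b) {B : ℝ} (hkB : ∀ t, ‖k t‖ ≤ B)
    (hd1 : ∀ t, ‖d t‖ ≤ 1) {U C : Set (Fin n → ℂ)} (hU : IsOpen U) (hC : IsCompact C)
    (hCU : C ⊆ U) {f : (Fin n → ℂ) → ℂ} (hf : DifferentiableOn ℂ f U) {z₀ : Fin n → ℂ}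
    (hz₀ : ∀ t, d t * z₀ + b t ∈ C) :
    Integrable (fun t => k t • (fderiv ℂ f (d t * z₀ + b t)).comp
        (ContinuousLinearMap.mul ℂ (Fin n → ℂ) (d t))) μ ∧
    HasFDerivAt (fun z => ∫ t, k t * f (d t * z + b t) ∂μ)
      (∫ t, k t • (fderiv ℂ f (d t * z₀ + b t)).comp
        (ContinuousLinearMap.mul ℂ (Fin n → ℂ) (d t)) ∂μ) z₀ := by
  -- a bounded neighbourhood of `C` on which `f` is bounded
  obtain ⟨δ, hδ, hδU⟩ : ∃ δ > 0, cthickening δ C ⊆ U := hC.exists_cthickening_subset_open hU hCU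
  have hK : IsCompact (cthickening δ C) := hC.cthickening
  obtain ⟨M, hM⟩ := hK.exists_bound_of_continuousOn (hf.continuousOn.mono hδU)
  have hmem : ∀ z ∈ ball z₀ (δ / 2), ∀ t, ball (d t * z + b t) (δ / 2) ⊆ cthickening δ C := by
    intro z hz t x hx
    refine mem_cthickening_of_dist_le x (d t * z₀ + b t) δ C (hz₀ t) ?_
    have h1 : dist (d t * z + b t) (d t * z₀ + b t) ≤ δ / 2 := by
      rw [dist_eq_norm, add_sub_add_right_eq_sub, ← mul_sub]
      calc ‖d t * (z - z₀)‖ ≤ ‖d t‖ * ‖z - z₀‖ := norm_mul_le _ _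
        _ ≤ 1 * ‖z - z₀‖ := by gcongr; exact hd1 t
        _ ≤ δ / 2 := by rw [one_mul, ← dist_eq_norm]; exact (mem_ball.1 hz).le
    linarith [dist_triangle x (d t * z + b t) (d t * z₀ + b t), mem_ball.1 hx]
  have hmemU : ∀ z ∈ ball z₀ (δ / 2), ∀ t, d t * z + b t ∈ U := fun z hz t =>
    hδU (hmem z hz t (mem_ball_self (by positivity)))
  have hz₀b : z₀ ∈ ball z₀ (δ / 2) := mem_ball_self (by positivity)
  have hcont : ∀ z ∈ ball z₀ (δ / 2), Continuous fun t => k t * f (d t * z + b t) := by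
    intro z hz
    refine hk.mul ?_
    exact hf.continuousOn.comp_continuous (by fun_prop) (hmemU z hz)
  have hM' : ∀ z ∈ ball z₀ (δ / 2), ∀ t, ‖f (d t * z + b t)‖ ≤ M := fun z hz t =>
    hM _ (hmem z hz t (mem_ball_self (by positivity)))
  have hmeas : AEStronglyMeasurable (fun t => k t • (fderiv ℂ f (d t * z₀ + b t)).comp
        (ContinuousLinearMap.mul ℂ (Fin n → ℂ) (d t))) μ := by
    refine hk.aestronglyMeasurable.smul ?_
    have h1 : Measurable fun t => fderiv ℂ f (d t * z₀ + b t) :=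
      (measurable_fderiv ℂ f).comp (by fun_prop : Continuous fun t => d t * z₀ + b t).measurable
    have h2 : Continuous fun t => ContinuousLinearMap.mul ℂ (Fin n → ℂ) (d t) := by fun_prop
    have h3 : StronglyMeasurable fun t => fderiv ℂ f (d t * z₀ + b t) := h1.stronglyMeasurable
    have h4 := (isBoundedBilinearMap_comp (𝕜 := ℂ) (E := Fin n → ℂ) (F := Fin n → ℂ)
      (G := ℂ)).continuous.comp_stronglyMeasurable (h3.prodMk h2.stronglyMeasurable)
    exact h4.aestronglyMeasurable
  have hbound : ∀ t, ∀ z ∈ ball z₀ (δ / 2), ‖k t • (fderiv ℂ f (d t * z + b t)).comp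
        (ContinuousLinearMap.mul ℂ (Fin n → ℂ) (d t))‖ ≤ B * (2 * M / (δ / 2)) := by
    intro t z hz
    have h1 : ‖fderiv ℂ f (d t * z + b t)‖ ≤ 2 * M / (δ / 2) :=
      norm_fderiv_le_of_forall_mem_ball (by positivity)
        (hf.mono ((hmem z hz t).trans hδU)) fun x hx => hM x (hmem z hz t hx)
    have h2 : ‖ContinuousLinearMap.mul ℂ (Fin n → ℂ) (d t)‖ ≤ 1 :=
      (ContinuousLinearMap.opNorm_mul_apply_le ℂ _ _).trans (hd1 t)
    rw [norm_smul]
    have hB : 0 ≤ B := (norm_nonneg _).trans (hkB t)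
    refine mul_le_mul (hkB t) ?_ (norm_nonneg _) hB
    refine (ContinuousLinearMap.opNorm_comp_le _ _).trans ?_
    calc _ ≤ (2 * M / (δ / 2)) * 1 := mul_le_mul h1 h2 (norm_nonneg _) ((norm_nonneg _).trans h1)
      _ = _ := mul_one _
  refine ⟨Integrable.of_bound hmeas _ (Eventually.of_forall fun t => hbound t z₀ hz₀b), ?_⟩
  refine hasFDerivAt_integral_of_dominated_of_fderiv_le (s := ball z₀ (δ / 2))
    (F := fun z t => k t * f (d t * z + b t))
    (F' := fun z t => k t • (fderiv ℂ f (d t * z + b t)).comp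
        (ContinuousLinearMap.mul ℂ (Fin n → ℂ) (d t)))
    (bound := fun _ => B * (2 * M / (δ / 2)))
    (ball_mem_nhds _ (by positivity)) ?_ ?_ hmeas
    (Eventually.of_forall hbound) (integrable_const _) (Eventually.of_forall ?_)
  · filter_upwards [ball_mem_nhds z₀ (by positivity : 0 < δ / 2)] with z hz
    exact (hcont z hz).aestronglyMeasurable
  · refine Integrable.of_bound (hcont z₀ hz₀b).aestronglyMeasurable (B * M)
      (Eventually.of_forall fun t => ?_)
    rw [norm_mul]
    exact mul_le_mul (hkB t) (hM' z₀ hz₀b t) (norm_nonneg _) ((norm_nonneg _).trans (hkB t))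
  · intro t z hz
    have h1 : HasFDerivAt f (fderiv ℂ f (d t * z + b t)) (d t * z + b t) :=
      (hf.differentiableAt (hU.mem_nhds (hmemU z hz t))).hasFDerivAt
    have h2 : HasFDerivAt (fun z => d t * z + b t)
        (ContinuousLinearMap.mul ℂ (Fin n → ℂ) (d t)) z :=
      ((ContinuousLinearMap.mul ℂ (Fin n → ℂ) (d t)).hasFDerivAt).add_const _
    exact (HasFDerivAt.comp z h1 h2).const_mul (k t)

theorem hasDerivAt_add_single {n : ℕ} (z : Fin n → ℂ) (j : Fin n) (s : ℂ) :
    HasDerivAt (fun s : ℂ => z + Pi.single j s) (Pi.single j (1 : ℂ) : Fin n → ℂ) s :=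
  (ContinuousLinearMap.single ℂ (fun _ : Fin n => ℂ) j).hasDerivAt.const_add z

/-- The Cauchy integral for a partial derivative, written as an average over affine images `1 * z + b`
of the argument so that `hasFDerivAt_integral_comp_affine` applies. -/
theorem pderiv_eq_integral {n : ℕ} {U : Set (Fin n → ℂ)} (hU : IsOpen U) (j : Fin n)
    {f : (Fin n → ℂ) → ℂ} (hf : DifferentiableOn ℂ f U) {z : Fin n → ℂ} {ρ : ℝ} (hρ : 0 < ρ)
    (hz : closedBall z ρ ⊆ U) :
    pderiv j f z = ∫ θ in Ioc 0 (2 * Real.pi), ((2 * Real.pi * Complex.I)⁻¹ *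
      (deriv (circleMap 0 ρ) θ * ((circleMap 0 ρ θ) ^ 2)⁻¹)) *
        f (1 * z + Pi.single j (circleMap 0 ρ θ)) := by
  have hg : ∀ s ∈ closedBall (0 : ℂ) ρ, z + Pi.single j s ∈ U := by
    intro s hs
    apply hz
    rw [mem_closedBall_zero_iff] at hs
    rwa [mem_closedBall, dist_eq_norm, add_sub_cancel_left, Pi.norm_single]
  have hgd : ∀ s ∈ closedBall (0 : ℂ) ρ,
      HasDerivAt (fun s : ℂ => f (z + Pi.single j s)) (pderiv j f (z + Pi.single j s)) s := by
    intro s hs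
    exact (hf.differentiableAt (hU.mem_nhds (hg s hs))).hasFDerivAt.comp_hasDerivAt s
      (hasDerivAt_add_single z j s)
  have h0 := (hgd 0 (by simp [hρ.le])).deriv
  rw [Pi.single_zero, add_zero] at h0
  have h1 := Complex.differentiable_on_off_countable_deriv_eq_smul_circleIntegral hρ
    countable_empty (fun s hs => (hgd s hs).continuousAt.continuousWithinAt)
    (fun s hs => (hgd s (ball_subset_closedBall hs.1)).differentiableAt)
  rw [h0, circleIntegral, intervalIntegral.integral_of_le (by positivity)] at h1
  have h2 : pderiv j f z = (2 * Real.pi * Complex.I)⁻¹ *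
      ((2 * Real.pi * Complex.I : ℂ) • pderiv j f z) := by
    rw [smul_eq_mul, inv_mul_cancel_left₀ Complex.two_pi_I_ne_zero]
  rw [h2, ← h1, ← integral_const_mul]
  refine integral_congr_ae (Eventually.of_forall fun θ => ?_)
  simp only [smul_eq_mul, sub_zero, one_div, one_mul]
  ring

/-- Partial derivatives of holomorphic functions are holomorphic: differentiate the Cauchy integral
for `∂f/∂z_j` over a small circle in the `j`-th variable. -/
theorem differentiableOn_pderiv {n : ℕ} {U : Set (Fin n → ℂ)} (hU : IsOpen U) (j : Fin n)
    {f : (Fin n → ℂ) → ℂ} (hf : DifferentiableOn ℂ f U) : DifferentiableOn ℂ (pderiv j f) U := by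
  intro z₀ hz₀
  obtain ⟨r, hr, hrU⟩ := Metric.isOpen_iff.1 hU z₀ hz₀
  obtain ⟨ρ, hρ0, hρr⟩ : ∃ ρ > 0, 2 * ρ < r := ⟨r / 3, by positivity, by linarith⟩
  have hρ : ∀ θ, ‖circleMap 0 ρ θ‖ = ρ := fun θ => by simp [abs_of_pos hρ0]
  have hcm := continuous_circleMap 0 ρ
  have key := (hasFDerivAt_integral_comp_affine (n := n)
    (volume.restrict (Ioc 0 (2 * Real.pi)))
    (k := fun θ => (2 * Real.pi * Complex.I)⁻¹ *
      (deriv (circleMap 0 ρ) θ * ((circleMap 0 ρ θ) ^ 2)⁻¹))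
    (d := fun _ => 1) (b := fun θ => Pi.single j (circleMap 0 ρ θ))
    (B := ‖(2 * Real.pi * Complex.I : ℂ)⁻¹‖ * (ρ * (ρ ^ 2)⁻¹))
    ?_ continuous_const ?_ ?_ ?_ hU (C := closedBall z₀ ρ) (isCompact_closedBall _ _)
    ((closedBall_subset_ball (by linarith)).trans hrU) hf (z₀ := z₀) ?_).2
  · refine (key.differentiableAt.congr_of_eventuallyEq ?_).differentiableWithinAt
    filter_upwards [ball_mem_nhds z₀ hρ0] with z hz
    refine pderiv_eq_integral hU j hf hρ0 ((closedBall_subset_ball' ?_).trans hrU)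
    linarith [mem_ball.1 hz]
  · simp only [deriv_circleMap]
    refine continuous_const.mul ((hcm.mul continuous_const).mul ((hcm.pow 2).inv₀ fun θ => ?_))
    exact pow_ne_zero _ (norm_pos_iff.1 (by rw [hρ]; exact hρ0))
  · exact (ContinuousLinearMap.single ℂ (fun _ : Fin n => ℂ) j).continuous.comp hcm
  · intro θ
    rw [norm_mul, norm_mul, norm_inv ((_ : ℂ) ^ 2), norm_pow, hρ, deriv_circleMap, norm_mul, hρ,
      Complex.norm_I, mul_one]
  · intro _
    exact (pi_norm_le_iff_of_nonneg zero_le_one).2 fun i => by simp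
  · intro θ
    rw [mem_closedBall, dist_eq_norm, one_mul, add_sub_cancel_left, Pi.norm_single, hρ]

theorem pderiv_eqOn {n : ℕ} {U : Set (Fin n → ℂ)} (hU : IsOpen U) (j : Fin n)
    {f g : (Fin n → ℂ) → ℂ} (hfg : EqOn f g U) : EqOn (pderiv j f) (pderiv j g) U := by
  intro z hz
  have : f =ᶠ[𝓝 z] g := hfg.eventuallyEq_of_mem (hU.mem_nhds hz)
  simp [pderiv, this.fderiv_eq]

/-- Induction on the list of partial derivatives making up `mderiv ν`. -/
theorem mderiv_induction {n : ℕ} {P : ((Fin n → ℂ) → ℂ) → ((Fin n → ℂ) → ℂ) → Prop}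
    (hP : ∀ j f g, P f g → P (pderiv j f) (pderiv j g)) (ν : Fin n → ℕ)
    {f g : (Fin n → ℂ) → ℂ} (h : P f g) : P (mderiv ν f) (mderiv ν g) := by
  unfold mderiv
  induction List.finRange n with
  | nil => exact h
  | cons j l ih =>
    simp only [List.foldr_cons]
    generalize ν j = m
    induction m with
    | zero => exact ih
    | succ m ihm =>
      rw [Function.iterate_succ_apply', Function.iterate_succ_apply']
      exact hP _ _ _ ihm

theorem mderiv_eqOn {n : ℕ} {U : Set (Fin n → ℂ)} (hU : IsOpen U) (ν : Fin n → ℕ)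
    {f g : (Fin n → ℂ) → ℂ} (hfg : EqOn f g U) : EqOn (mderiv ν f) (mderiv ν g) U :=
  mderiv_induction (P := fun f g => EqOn f g U) (fun j _ _ h => pderiv_eqOn hU j h) ν hfg

theorem differentiableOn_mderiv {n : ℕ} {U : Set (Fin n → ℂ)} (hU : IsOpen U) (ν : Fin n → ℕ)
    {f : (Fin n → ℂ) → ℂ} (hf : DifferentiableOn ℂ f U) : DifferentiableOn ℂ (mderiv ν f) U :=
  mderiv_induction (P := fun f _ => DifferentiableOn ℂ f U)
    (fun j _ _ h => differentiableOn_pderiv hU j h) ν (g := f) hf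

/-- Coordinates outside `S` can be made nonzero by an arbitrarily small perturbation which keeps
the coordinates in `S`. -/
theorem exists_mem_forall_ne_zero {n : ℕ} {U : Set (Fin n → ℂ)} {z : Fin n → ℂ} (hU : U ∈ 𝓝 z)
    (S : Set (Fin n)) : ∃ w ∈ U, (∀ j ∈ S, w j = z j) ∧ ∀ j ∉ S, w j ≠ 0 := by
  classical
  let w : ℝ → Fin n → ℂ := fun δ j => if j ∈ S then z j else if z j = 0 then (δ : ℂ) else z j
  have hw0 : w 0 = z := by
    ext j
    by_cases h : z j = 0 <;> simp [w, h]
  have hw : ContinuousAt w 0 := by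
    refine Continuous.continuousAt (continuous_pi fun j => ?_)
    by_cases h1 : j ∈ S <;> by_cases h2 : z j = 0 <;> simp [w, h1, h2] <;> fun_prop
  have h1 : ∀ᶠ δ : ℝ in 𝓝[>] 0, w δ ∈ U :=
    (hw.tendsto.mono_left nhdsWithin_le_nhds).eventually (by rw [hw0]; exact hU)
  obtain ⟨δ, hδU, hδ⟩ := (h1.and self_mem_nhdsWithin).exists
  have hδ0 : (δ : ℂ) ≠ 0 := by exact_mod_cast (ne_of_gt hδ : δ ≠ 0)
  refine ⟨w δ, hδU, fun j hj => by simp [w, hj], fun j hj => ?_⟩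
  by_cases h2 : z j = 0 <;> simp [w, hj, h2, hδ0]

/-! ### Laurent monomials -/

/-- The Laurent monomial `z^α`. Since `0⁻¹ = 0`, it is only meaningful at points with `z_j ≠ 0`
whenever `α_j < 0`. -/
noncomputable def mon {n : ℕ} (α : Fin n → ℤ) (z : Fin n → ℂ) : ℂ := ∏ j, z j ^ α j

/-- The points at which the Laurent monomial `z^α` has no pole. -/
def monDomain {n : ℕ} (α : Fin n → ℤ) : Set (Fin n → ℂ) := {z | ∀ j, α j < 0 → z j ≠ 0}

theorem isOpen_monDomain {n : ℕ} (α : Fin n → ℤ) : IsOpen (monDomain α) := by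
  have : monDomain α = ⋂ j, {z : Fin n → ℂ | α j < 0 → z j ≠ 0} := by
    ext; simp [monDomain]
  rw [this]
  refine isOpen_iInter_of_finite fun j => ?_
  by_cases h : α j < 0
  · simpa [h] using isOpen_ne_fun (continuous_apply j) continuous_const
  · simp [h]

theorem differentiableOn_mon {n : ℕ} (α : Fin n → ℤ) :
    DifferentiableOn ℂ (mon α) (monDomain α) := by
  intro z hz
  refine DifferentiableAt.differentiableWithinAt ?_
  change DifferentiableAt ℂ (fun z : Fin n → ℂ => ∏ j, z j ^ α j) z
  have h : ∀ j ∈ Finset.univ, DifferentiableAt ℂ (fun z : Fin n → ℂ => z j ^ α j) z := by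
    intro j _
    have h : z j ≠ 0 ∨ 0 ≤ α j := by
      by_cases h : α j < 0
      · exact Or.inl (hz j h)
      · exact Or.inr (not_lt.1 h)
    exact (differentiableAt_zpow.2 h).comp z
      (ContinuousLinearMap.proj (R := ℂ) (φ := fun _ : Fin n => ℂ) j).differentiableAt
  exact (HasFDerivAt.finsetProd fun j hj => (h j hj).hasFDerivAt).differentiableAt

theorem mon_mul {n : ℕ} (α : Fin n → ℤ) (z w : Fin n → ℂ) :
    mon α (z * w) = mon α z * mon α w := by
  simp [mon, mul_zpow, Finset.prod_mul_distrib]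

/-- The points of `ℂⁿ` off the coordinate hyperplanes. -/
def offAxes (n : ℕ) : Set (Fin n → ℂ) := {z | ∀ j, z j ≠ 0}

theorem isOpen_offAxes (n : ℕ) : IsOpen (offAxes n) := by
  simp only [offAxes, ofPred_forall]
  exact isOpen_iInter_of_finite fun j => isOpen_ne_fun (continuous_apply j) continuous_const

theorem mon_ne_zero {n : ℕ} (α : Fin n → ℤ) {z : Fin n → ℂ} (hz : z ∈ offAxes n) : mon α z ≠ 0 :=
  Finset.prod_ne_zero_iff.2 fun j _ => zpow_ne_zero _ (hz j)

theorem mon_mul_mon_neg {n : ℕ} (α : Fin n → ℤ) {z : Fin n → ℂ} (hz : z ∈ offAxes n) :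
    mon α z * mon (-α) z = 1 := by
  rw [mon, mon, ← Finset.prod_mul_distrib]
  refine Finset.prod_eq_one fun j _ => ?_
  rw [← zpow_add₀ (hz j)]
  simp

/-- The positive part `∏_{α_j > 0} z_j^{α_j}`, the numerator of a Laurent monomial. -/
noncomputable def monNum {n : ℕ} (α : Fin n → ℤ) (z : Fin n → ℂ) : ℂ := ∏ j, z j ^ (α j).toNat

theorem differentiable_monNum {n : ℕ} (α : Fin n → ℤ) : Differentiable ℂ (monNum α) := by
  unfold monNum
  fun_prop

theorem mon_mul_monNum_neg {n : ℕ} (α : Fin n → ℤ) {z : Fin n → ℂ} (hz : z ∈ monDomain α) :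
    mon α z * monNum (-α) z = monNum α z := by
  rw [mon, monNum, monNum, ← Finset.prod_mul_distrib]
  refine Finset.prod_congr rfl fun j _ => ?_
  rcases lt_or_ge (α j) 0 with h | h
  · have h0 : z j ≠ 0 := hz j h
    rw [Int.toNat_of_nonpos h.le, Pi.neg_apply, ← zpow_natCast (z j), Int.toNat_of_nonneg (by omega),
      ← zpow_add₀ h0]
    simp
  · rw [Pi.neg_apply, Int.toNat_of_nonpos (by omega), ← zpow_natCast (z j) (α j).toNat,
      Int.toNat_of_nonneg h]
    simp

/-- If `a z^α` agrees with an everywhere finite function `h` on an open set after clearing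
denominators, and `a ≠ 0`, then that open set does not meet the poles of `z^α`. -/
theorem subset_monDomain_of_mul_eq {n : ℕ} {α : Fin n → ℤ} {U : Set (Fin n → ℂ)} (hU : IsOpen U)
    {h : (Fin n → ℂ) → ℂ} {a : ℂ} (ha : a ≠ 0)
    (H : ∀ z ∈ U, h z * monNum (-α) z = a * monNum α z) : U ⊆ monDomain α := by
  intro z hz j hj hzj
  obtain ⟨w, hwU, hw1, hw2⟩ := exists_mem_forall_ne_zero (hU.mem_nhds hz) {j}
  have hwj : w j = 0 := (hw1 j rfl).trans hzj
  have h1 : monNum (-α) w = 0 := by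
    refine Finset.prod_eq_zero (Finset.mem_univ j) ?_
    rw [hwj, zero_pow]
    simp only [Pi.neg_apply]
    omega
  have h2 : monNum α w ≠ 0 := by
    refine Finset.prod_ne_zero_iff.2 fun i _ => ?_
    by_cases hi : i = j
    · subst hi
      simp [Int.toNat_of_nonpos hj.le]
    · exact pow_ne_zero _ (hw2 i hi)
  have h3 := H w hwU
  rw [h1, mul_zero] at h3
  exact mul_ne_zero ha h2 h3.symm

/-! ### Series of Laurent monomials -/

theorem summable_pow_sum_natAbs {θ : ℝ} (h0 : 0 ≤ θ) (h1 : θ < 1) (n : ℕ) :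
    Summable fun α : Fin n → ℤ => θ ^ ∑ j, (α j).natAbs := by
  have hZ : Summable fun m : ℤ => θ ^ m.natAbs := by
    refine Summable.of_nat_of_neg ?_ ?_ <;>
    simpa using summable_geometric_of_lt_one h0 h1
  induction n with
  | zero => exact Summable.of_finite
  | succ n ih =>
    rw [← (Fin.consEquiv fun _ => ℤ).summable_iff]
    refine (hZ.mul_of_nonneg ih (fun _ => by positivity) fun _ => by positivity).congr fun p => ?_
    simp [Fin.consEquiv, Fin.sum_univ_succ, pow_add]

/-- The point with coordinates enlarged by `t` where `α_j ≥ 0`, and shrunk by `t` elsewhere: the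
modulus of `z^α` grows by the factor `t^|α|`. -/
theorem mon_stretch {n : ℕ} (α : Fin n → ℤ) (z : Fin n → ℂ) {t : ℝ} (ht : 0 < t) :
    ‖mon α (fun j => (if 0 ≤ α j then (t : ℂ) else (t : ℂ)⁻¹) * z j)‖ =
      t ^ (∑ j, (α j).natAbs) * ‖mon α z‖ := by
  have h := mon_mul α (fun j => if 0 ≤ α j then (t : ℂ) else (t : ℂ)⁻¹) z
  change mon α (fun j => (if 0 ≤ α j then (t : ℂ) else (t : ℂ)⁻¹) * z j) = _ at h
  rw [h, norm_mul]
  congr 1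
  rw [mon, norm_prod, ← Finset.prod_pow_eq_pow_sum]
  refine Finset.prod_congr rfl fun j _ => ?_
  split_ifs with hj
  · rw [norm_zpow, Complex.norm_real, Real.norm_of_nonneg ht.le, ← zpow_natCast]
    congr 1
    omega
  · rw [norm_zpow, norm_inv, Complex.norm_real, Real.norm_of_nonneg ht.le, inv_zpow', ← zpow_natCast]
    congr 1
    omega

/-- A series of Laurent monomials whose terms are locally uniformly bounded on an open set `U` is
locally dominated there by a geometric series. -/
theorem exists_norm_mon_le {n : ℕ} {U : Set (Fin n → ℂ)} {a : (Fin n → ℤ) → ℂ}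
    (hbd : ∀ q ∈ U, ∃ M : ℝ, ∀ᶠ z in 𝓝 q, ∀ α, ‖a α * mon α z‖ ≤ M) {q : Fin n → ℂ}
    (hq : q ∈ U) : ∃ M θ : ℝ, 0 ≤ θ ∧ θ < 1 ∧
      ∀ᶠ z in 𝓝 q, ∀ α, ‖a α * mon α z‖ ≤ M * θ ^ ∑ j, (α j).natAbs := by
  obtain ⟨M, hM⟩ := hbd q hq
  obtain ⟨r, hr, hrM⟩ := Metric.eventually_nhds_iff_ball.1 hM
  obtain ⟨η, hη, hηr⟩ : ∃ η > 0, η * (‖q‖ + r) < r / 2 := by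
    refine ⟨r / (4 * (‖q‖ + r)), by positivity, ?_⟩
    have : 0 < ‖q‖ + r := by positivity
    rw [div_mul_eq_mul_div, div_lt_div_iff₀ (by positivity) (by positivity)]
    nlinarith [mul_pos hr this]
  refine ⟨M, (1 + η)⁻¹, by positivity, inv_lt_one_of_one_lt₀ (by linarith), ?_⟩
  filter_upwards [ball_mem_nhds q (by positivity : 0 < r / 2)] with z hz α
  set w : Fin n → ℂ := fun j => (if 0 ≤ α j then ((1 + η : ℝ) : ℂ) else ((1 + η : ℝ) : ℂ)⁻¹) * z j
    with hw
  have hwz : dist w z ≤ η * ‖z‖ := by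
    rw [dist_pi_le_iff (by positivity)]
    intro j
    have hzj := norm_le_pi_norm z j
    rw [dist_eq_norm, hw]
    simp only
    have e : (if 0 ≤ α j then ((1 + η : ℝ) : ℂ) else ((1 + η : ℝ) : ℂ)⁻¹) * z j - z j =
        (((if 0 ≤ α j then (1 + η : ℝ) else (1 + η : ℝ)⁻¹) - 1 : ℝ) : ℂ) * z j := by
      split_ifs <;> push_cast <;> ring
    rw [e, norm_mul, Complex.norm_real]
    refine mul_le_mul ?_ hzj (norm_nonneg _) hη.le
    rw [Real.norm_eq_abs]
    split_ifs
    · rw [abs_of_nonneg (by linarith)]; linarith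
    · have h1 : (1 + η)⁻¹ ≤ 1 := inv_le_one_of_one_le₀ (by linarith)
      have h2 : 1 - η ≤ (1 + η)⁻¹ := by
        rw [inv_eq_one_div, le_div_iff₀ (by positivity)]
        nlinarith
      rw [abs_le]; constructor <;> linarith
  have hwr : w ∈ ball q r := by
    have hz' := mem_ball.1 hz
    have h1 : ‖z‖ ≤ ‖q‖ + r := by
      have := norm_le_norm_add_norm_sub' z q
      rw [← dist_eq_norm] at this
      linarith
    have h2 : η * ‖z‖ ≤ η * (‖q‖ + r) := by gcongr
    rw [mem_ball]
    linarith [dist_triangle w z q]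
  have h := hrM w hwr α
  rw [norm_mul, hw, mon_stretch α z (by positivity)] at h
  rw [norm_mul, inv_pow, ← div_eq_mul_inv, le_div_iff₀ (by positivity)]
  linarith

/-- A series of Laurent monomials without poles in the open set `U` whose terms are locally
uniformly bounded on `U` converges to a holomorphic function there. -/
theorem summable_and_differentiableOn_tsum_mon {n : ℕ} {U : Set (Fin n → ℂ)} (hU : IsOpen U)
    {a : (Fin n → ℤ) → ℂ} (hne : ∀ α, a α ≠ 0 → U ⊆ monDomain α)
    (hbd : ∀ q ∈ U, ∃ M : ℝ, ∀ᶠ z in 𝓝 q, ∀ α, ‖a α * mon α z‖ ≤ M) :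
    (∀ z ∈ U, Summable fun α => a α * mon α z) ∧
      DifferentiableOn ℂ (fun z => ∑' α, a α * mon α z) U := by
  have hsum : ∀ z ∈ U, Summable fun α => a α * mon α z := by
    intro z hz
    obtain ⟨M, θ, h0, h1, h⟩ := exists_norm_mon_le hbd hz
    exact Summable.of_norm_bounded ((summable_pow_sum_natAbs h0 h1 n).mul_left M) h.self_of_nhds
  refine ⟨hsum, fun q hq => DifferentiableAt.differentiableWithinAt ?_⟩
  obtain ⟨M, θ, h0, h1, h⟩ := exists_norm_mon_le hbd hq
  obtain ⟨r, hr, hrU⟩ := Metric.eventually_nhds_iff_ball.1 (h.and (hU.mem_nhds hq))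
  have hsub : ∀ z ∈ ball q (r / 2), ball z (r / 2) ⊆ ball q r := fun z hz =>
    ball_subset_ball' (by linarith [mem_ball.1 hz])
  have hdiff : ∀ α, DifferentiableOn ℂ (fun z => a α * mon α z) U := by
    intro α
    by_cases ha : a α = 0
    · simp [ha]
    · exact ((differentiableOn_mon α).mono (hne α ha)).const_mul _
  have hu : Summable fun α : Fin n → ℤ => 2 * (M * θ ^ ∑ j, (α j).natAbs) / (r / 2) :=
    ((((summable_pow_sum_natAbs h0 h1 n).mul_left M).mul_left 2).div_const _)
  have hmem : ∀ z ∈ ball q (r / 2), ∀ x ∈ ball z (r / 2), x ∈ ball q r :=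
    fun z hz x hx => hsub z hz hx
  have hf : ∀ α, ∀ z ∈ ball q (r / 2), HasFDerivAt (fun z => a α * mon α z)
      (fderiv ℂ (fun z => a α * mon α z) z) z := fun α z hz =>
    ((hdiff α).differentiableAt (hU.mem_nhds
      (hrU z (hmem z hz z (mem_ball_self (half_pos hr)))).2)).hasFDerivAt
  have hf' : ∀ α, ∀ z ∈ ball q (r / 2), ‖fderiv ℂ (fun z => a α * mon α z) z‖ ≤
      2 * (M * θ ^ ∑ j, (α j).natAbs) / (r / 2) := fun α z hz =>
    norm_fderiv_le_of_forall_mem_ball (half_pos hr)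
      ((hdiff α).mono fun x hx => (hrU x (hmem z hz x hx)).2) fun x hx => (hrU x (hmem z hz x hx)).1 α
  have hq0 : q ∈ ball q (r / 2) := mem_ball_self (half_pos hr)
  exact (hasFDerivAt_tsum_of_isPreconnected hu isOpen_ball (convex_ball q (r / 2)).isPreconnected
    hf hf' hq0 (hsum q hq) hq0).differentiableAt

/-! ### Laurent expansion on circled domains -/

/-- The point `(e^{2πi t_1}, …, e^{2πi t_n})` of the unit torus in `ℂⁿ`, with parameters in
`ℝ/ℤ`. -/
noncomputable def torusPt {n : ℕ} (t : UnitAddTorus (Fin n)) : Fin n → ℂ :=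
  fun j => fourier 1 (t j)

/-- The normalized Haar measure of the torus `(ℝ/ℤ)ⁿ`; it is the measure implicit in
`UnitAddTorus.mFourierCoeff`. -/
noncomputable def haarTorus (n : ℕ) : Measure (UnitAddTorus (Fin n)) :=
  Measure.pi fun _ => AddCircle.haarAddCircle

instance (n : ℕ) : IsProbabilityMeasure (haarTorus n) := by
  unfold haarTorus; infer_instance

instance (n : ℕ) : (haarTorus n).IsAddRightInvariant := by
  unfold haarTorus; infer_instance

theorem continuous_torusPt {n : ℕ} : Continuous (torusPt (n := n)) := by
  unfold torusPt; fun_prop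

theorem norm_torusPt_apply {n : ℕ} (t : UnitAddTorus (Fin n)) (j : Fin n) : ‖torusPt t j‖ = 1 := by
  rw [torusPt, fourier_apply, Circle.norm_coe]

theorem norm_torusPt_le {n : ℕ} (t : UnitAddTorus (Fin n)) : ‖torusPt t‖ ≤ 1 :=
  (pi_norm_le_iff_of_nonneg zero_le_one).2 fun j => (norm_torusPt_apply t j).le

theorem torusPt_zero {n : ℕ} : torusPt (0 : UnitAddTorus (Fin n)) = 1 := by
  ext j; simp [torusPt]

theorem torusPt_add {n : ℕ} (s t : UnitAddTorus (Fin n)) :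
    torusPt (s + t) = torusPt s * torusPt t := by
  ext j
  simp only [torusPt, Pi.mul_apply, Pi.add_apply, fourier_one, AddCircle.toCircle_add,
    Circle.coe_mul]

theorem mon_torusPt {n : ℕ} (α : Fin n → ℤ) (t : UnitAddTorus (Fin n)) :
    mon α (torusPt t) = UnitAddTorus.mFourier α t := by
  simp [mon, torusPt, UnitAddTorus.mFourier, AddCircle.toCircle_zsmul]

theorem norm_mFourier_apply {n : ℕ} (α : Fin n → ℤ) (t : UnitAddTorus (Fin n)) :
    ‖UnitAddTorus.mFourier α t‖ = 1 := by
  rw [← mon_torusPt, mon, norm_prod]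
  simp [norm_torusPt_apply]

theorem IsCircled.torusPt_mul_mem {n : ℕ} {G : Set (Fin n → ℂ)} (hG : IsCircled G)
    (t : UnitAddTorus (Fin n)) {z : Fin n → ℂ} (hz : z ∈ G) : torusPt t * z ∈ G := by
  choose x hx using fun j => QuotientAddGroup.mk_surjective (t j)
  convert hG z hz (fun j => 2 * Real.pi * x j) using 1
  ext j
  have : torusPt t j = Complex.exp (Complex.I * ((2 * Real.pi * x j : ℝ) : ℂ)) := by
    rw [torusPt, ← hx j]
    refine (fourier_coe_apply (T := 1) (n := 1) (x := x j)).trans ?_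
    congr 1
    push_cast
    ring
  simp [this]

/-- The component of `f` of multidegree `α` under the action of the torus. For holomorphic `f` on a
circled domain this is the term of degree `α` of the Laurent series. -/
noncomputable def component {n : ℕ} (α : Fin n → ℤ) (f : (Fin n → ℂ) → ℂ) (z : Fin n → ℂ) : ℂ :=
  UnitAddTorus.mFourierCoeff (fun t => f (torusPt t * z)) α

theorem component_eq_integral {n : ℕ} (α : Fin n → ℤ) (f : (Fin n → ℂ) → ℂ) (z : Fin n → ℂ) :
    component α f z =
      ∫ t, UnitAddTorus.mFourier (-α) t * f (torusPt t * z) ∂(haarTorus n) := rfl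

/-- Cauchy's inequality for the components. -/
theorem norm_component_le {n : ℕ} (α : Fin n → ℤ) {f : (Fin n → ℂ) → ℂ} {z : Fin n → ℂ} {M : ℝ}
    (hM : ∀ t, ‖f (torusPt t * z)‖ ≤ M) : ‖component α f z‖ ≤ M := by
  rw [component_eq_integral]
  refine (norm_integral_le_of_norm_le_const (C := M) (Eventually.of_forall fun t => ?_)).trans ?_
  · rw [norm_mul, norm_mFourier_apply, one_mul]
    exact hM t
  · simp

theorem component_torusPt_mul {n : ℕ} (α : Fin n → ℤ) (f : (Fin n → ℂ) → ℂ) (z : Fin n → ℂ)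
    (s : UnitAddTorus (Fin n)) :
    component α f (torusPt s * z) = mon α (torusPt s) * component α f z := by
  rw [component_eq_integral, component_eq_integral, ← integral_const_mul,
    ← integral_add_right_eq_self (fun t => mon α (torusPt s) *
      (UnitAddTorus.mFourier (-α) t * f (torusPt t * z))) s]
  refine integral_congr_ae (Eventually.of_forall fun t => ?_)
  have h : mon α (torusPt s) * mon (-α) (torusPt s) = 1 := by
    rw [mon_torusPt, mon_torusPt, ← UnitAddTorus.mFourier_add, add_neg_cancel,
      UnitAddTorus.mFourier_zero, ContinuousMap.one_apply]
  simp only [← mon_torusPt, torusPt_add, mon_mul, mul_assoc]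
  linear_combination -(mon (-α) (torusPt t) * f (torusPt t * (torusPt s * z))) * h

variable {n : ℕ} {G : Set (Fin n → ℂ)}

theorem hasFDerivAt_component (hG : IsOpen G) (hc : IsCircled G)
    {f : (Fin n → ℂ) → ℂ} (hf : DifferentiableOn ℂ f G) (α : Fin n → ℤ) {z : Fin n → ℂ}
    (hz : z ∈ G) :
    Integrable (fun t => UnitAddTorus.mFourier (-α) t • (fderiv ℂ f (torusPt t * z)).comp
        (ContinuousLinearMap.mul ℂ (Fin n → ℂ) (torusPt t))) (haarTorus n) ∧
    HasFDerivAt (component α f)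
      (∫ t, UnitAddTorus.mFourier (-α) t • (fderiv ℂ f (torusPt t * z)).comp
        (ContinuousLinearMap.mul ℂ (Fin n → ℂ) (torusPt t)) ∂(haarTorus n)) z := by
  have h := hasFDerivAt_integral_comp_affine (haarTorus n) (k := UnitAddTorus.mFourier (-α))
    (d := torusPt) (b := fun _ => 0) (B := 1) (ContinuousMap.continuous _) continuous_torusPt
    continuous_const (fun t => (norm_mFourier_apply _ t).le) norm_torusPt_le hG
    (C := range fun t => torusPt t * z)
    (isCompact_range (continuous_torusPt.mul continuous_const))
    (range_subset_iff.2 fun t => hc.torusPt_mul_mem t hz) hf (z₀ := z)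
    (fun t => ⟨t, (add_zero _).symm⟩)
  simp only [add_zero] at h
  exact h

theorem differentiableOn_component (hG : IsOpen G) (hc : IsCircled G)
    {f : (Fin n → ℂ) → ℂ} (hf : DifferentiableOn ℂ f G) (α : Fin n → ℤ) :
    DifferentiableOn ℂ (component α f) G := fun _ hz =>
  (hasFDerivAt_component hG hc hf α hz).2.differentiableAt.differentiableWithinAt

/-- Partial derivatives commute with taking components, up to a shift of the degree. -/
theorem pderiv_component (hG : IsOpen G) (hc : IsCircled G)
    {f : (Fin n → ℂ) → ℂ} (hf : DifferentiableOn ℂ f G) (α : Fin n → ℤ) (j : Fin n) :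
    EqOn (pderiv j (component α f)) (component (α - Pi.single j 1) (pderiv j f)) G := by
  intro z hz
  obtain ⟨h1, h2⟩ := hasFDerivAt_component hG hc hf α hz
  rw [pderiv, h2.fderiv, ContinuousLinearMap.integral_apply h1, component_eq_integral]
  refine integral_congr_ae (Eventually.of_forall fun t => ?_)
  have e : torusPt t * Pi.single j 1 = torusPt t j • (Pi.single j 1 : Fin n → ℂ) := by
    ext i
    by_cases hi : i = j
    · subst hi; simp
    · simp [hi]
  have e2 : UnitAddTorus.mFourier (-(α - Pi.single j 1)) t =
      UnitAddTorus.mFourier (-α) t * torusPt t j := by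
    rw [neg_sub', sub_neg_eq_add, UnitAddTorus.mFourier_add, UnitAddTorus.mFourier_single]
    rfl
  simp only [smul_apply, ContinuousLinearMap.comp_apply,
    ContinuousLinearMap.mul_apply', e, map_smul, smul_eq_mul, e2, pderiv]
  ring

theorem exists_mderiv_component (hG : IsOpen G) (hc : IsCircled G)
    {f : (Fin n → ℂ) → ℂ} (hf : DifferentiableOn ℂ f G) (α : Fin n → ℤ) (ν : Fin n → ℕ) :
    ∃ β, EqOn (mderiv ν (component α f)) (component β (mderiv ν f)) G := by
  have h := mderiv_induction
    (P := fun g f => DifferentiableOn ℂ f G ∧ ∃ β, EqOn g (component β f) G) ?_ ν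
    (f := component α f) (g := f) ⟨hf, α, fun _ _ => rfl⟩
  · exact h.2
  · rintro j g f ⟨hf, β, hβ⟩
    exact ⟨differentiableOn_pderiv hG j hf, β - Pi.single j 1,
      (pderiv_eqOn hG j hβ).trans (pderiv_component hG hc hf β j)⟩

/-- The component of multidegree `α` is a multiple of `z^α`, because its quotient by `z^α` is
invariant under the torus, so that all derivatives of the quotient vanish off the axes. -/
theorem exists_component_eq (hG : IsDom G) (hc : IsCircled G)
    {f : (Fin n → ℂ) → ℂ} (hf : DifferentiableOn ℂ f G) (α : Fin n → ℤ) :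
    ∃ a : ℂ, (a ≠ 0 → G ⊆ monDomain α) ∧ ∀ z ∈ G, component α f z = a * mon α z := by
  obtain ⟨hGo, hGc⟩ := hG
  have hcd := differentiableOn_component hGo hc hf α
  set V : Set (Fin n → ℂ) := G ∩ offAxes n with hV
  have hVo : IsOpen V := hGo.inter (isOpen_offAxes n)
  have hVdom : V ⊆ monDomain α := fun z hz j _ => hz.2 j
  set g : (Fin n → ℂ) → ℂ := fun z => component α f z * (mon α z)⁻¹ with hg
  have hgd : DifferentiableOn ℂ g V :=
    (hcd.mono inter_subset_left).mul (((differentiableOn_mon α).mono hVdom).inv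
      fun z (hz : z ∈ V) => mon_ne_zero α hz.2)
  have hgt : ∀ z ∈ V, ∀ t, g (torusPt t * z) = g z := by
    intro z hz t
    have : mon α (torusPt t) ≠ 0 := mon_ne_zero α fun j =>
      norm_pos_iff.1 (by rw [norm_torusPt_apply]; exact one_pos)
    simp only [hg, component_torusPt_mul, mon_mul]
    simp only [← div_eq_mul_inv]
    exact mul_div_mul_left _ _ this
  have hg' : ∀ z ∈ V, fderiv ℂ g z = 0 := by
    intro z hz
    have hgz := (hgd.differentiableAt (hVo.mem_nhds hz)).hasFDerivAt
    have hj : ∀ j, fderiv ℂ g z (Pi.single j 1) = 0 := by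
      intro j
      -- differentiate `g` along the orbit of `z` under rotations of the `j`-th coordinate
      let γ : ℝ → Fin n → ℂ := fun x => z + Pi.single j ((Complex.exp (x * Complex.I) - 1) * z j)
      have hγ : HasDerivAt γ (Pi.single j (Complex.I * z j)) 0 := by
        have h1 : HasDerivAt (fun x : ℝ => (Complex.exp (x * Complex.I) - 1) * z j)
            (Complex.I * z j) 0 := by
          have h2 : HasDerivAt (fun x : ℝ => (x : ℂ) * Complex.I) (1 * Complex.I) 0 :=
            (Complex.ofRealCLM.hasDerivAt (x := (0 : ℝ))).mul_const Complex.I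
          simpa using (h2.cexp.sub_const 1).mul_const (z j)
        have h3 := ((ContinuousLinearMap.single ℝ (fun _ : Fin n => ℂ) j).hasFDerivAt.comp_hasDerivAt
          (0 : ℝ) h1).const_add z
        exact h3
      have hγt : ∀ x, ∃ t, γ x = torusPt t * z := by
        intro x
        refine ⟨Pi.single j ((x / (2 * Real.pi) : ℝ) : UnitAddCircle), ?_⟩
        ext i
        by_cases hi : i = j
        · subst hi
          have : torusPt (Pi.single i ((x / (2 * Real.pi) : ℝ) : UnitAddCircle)) i =
              Complex.exp (x * Complex.I) := by
            rw [torusPt, Pi.single_eq_same]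
            refine (fourier_coe_apply (T := 1) (n := 1) (x := x / (2 * Real.pi))).trans ?_
            congr 1
            have := Real.pi_ne_zero
            push_cast
            field_simp
          simp [γ, this]
          ring
        · simp [γ, hi, torusPt]
      have hγ0 : γ 0 = z := by simp [γ]
      have h1 : HasDerivAt (g ∘ γ) (fderiv ℂ g z (Pi.single j (Complex.I * z j))) 0 := by
        have := (hγ0.symm ▸ hgz.restrictScalars ℝ :
          HasFDerivAt g ((fderiv ℂ g z).restrictScalars ℝ) (γ 0)).comp_hasDerivAt (0 : ℝ) hγ
        exact this
      have h2 : g ∘ γ = fun _ => g z := by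
        funext x
        obtain ⟨t, ht⟩ := hγt x
        simp only [Function.comp_apply, ht, hgt z hz t]
      rw [h2] at h1
      have h3 := h1.unique (hasDerivAt_const (0 : ℝ) (g z))
      have h4 : (Pi.single j (Complex.I * z j) : Fin n → ℂ) =
          (Complex.I * z j) • Pi.single j 1 := by
        rw [← Pi.single_smul]; simp
      rw [h4, map_smul, smul_eq_zero] at h3
      exact h3.resolve_left (mul_ne_zero Complex.I_ne_zero (hz.2 j))
    ext v
    have : v = ∑ j, v j • (Pi.single j 1 : Fin n → ℂ) := by
      ext i; simp [Finset.sum_apply, Pi.single_apply]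
    rw [this, map_sum]
    simp [hj]
  obtain ⟨p, hp⟩ := hGc.1
  obtain ⟨q, hqG, -, hq0⟩ := exists_mem_forall_ne_zero (hGo.mem_nhds hp) ∅
  have hqV : q ∈ V := ⟨hqG, fun j => hq0 j (by simp)⟩
  obtain ⟨r, hr, hrV⟩ := Metric.isOpen_iff.1 hVo q hqV
  have hconst : ∀ z ∈ ball q r, g z = g q := fun z hz =>
    isOpen_ball.is_const_of_fderiv_eq_zero (convex_ball q r).isPreconnected (hgd.mono hrV)
      (fun x hx => hg' x (hrV hx)) hz (mem_ball_self hr)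
  have key : EqOn (fun z => component α f z * monNum (-α) z) (fun z => g q * monNum α z) G := by
    refine eqOn_of_eqOn_isOpen hGo hGc.isPreconnected isOpen_ball ⟨q, mem_ball_self hr⟩
      (hrV.trans inter_subset_left) (hcd.mul (differentiable_monNum _).differentiableOn)
      ((differentiable_monNum _).differentiableOn.const_mul _) fun z hz => ?_
    have h1 := hconst z hz
    have h2 : mon α z ≠ 0 := mon_ne_zero α (hrV hz).2
    simp only [hg, ← div_eq_mul_inv, div_eq_iff h2] at h1
    rw [h1, mul_assoc, mon_mul_monNum_neg α (hVdom (hrV hz))]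
    simp only [hg, div_eq_mul_inv]
  have hdom : g q ≠ 0 → G ⊆ monDomain α := fun ha => subset_monDomain_of_mul_eq hGo ha key
  refine ⟨g q, hdom, fun z hz => ?_⟩
  by_cases ha : g q = 0
  · rw [ha, zero_mul]
    refine eqOn_of_eqOn_isOpen (g := fun _ => 0) hGo hGc.isPreconnected isOpen_ball
      ⟨q, mem_ball_self hr⟩ (hrV.trans inter_subset_left) hcd (differentiableOn_const _)
      (fun x hx => ?_) hz
    have h1 := hconst x hx
    rw [ha] at h1
    exact (mul_eq_zero.1 h1).resolve_right (inv_ne_zero (mon_ne_zero α (hrV hx).2))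
  · have h1 : component α f z * monNum (-α) z = g q * monNum α z := key hz
    rw [← mon_mul_monNum_neg α (hdom ha hz), ← mul_assoc] at h1
    refine mul_right_cancel₀ (Finset.prod_ne_zero_iff.2 fun j _ => ?_) h1
    by_cases hj : α j < 0
    · exact pow_ne_zero _ (hdom ha hz j hj)
    · rw [Pi.neg_apply, Int.toNat_of_nonpos (by omega), pow_zero]
      exact one_ne_zero

/-- A holomorphic function on a circled domain is bounded on the torus orbits of all points near a
given one. -/
theorem eventually_forall_norm_le (hG : IsOpen G) (hc : IsCircled G)
    {f : (Fin n → ℂ) → ℂ} (hf : ContinuousOn f G) {q : Fin n → ℂ} (hq : q ∈ G) :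
    ∃ M : ℝ, ∀ᶠ z in 𝓝 q, ∀ t, ‖f (torusPt t * z)‖ ≤ M := by
  have hcont : Continuous fun t => f (torusPt t * q) :=
    hf.comp_continuous (continuous_torusPt.mul continuous_const) fun t => hc.torusPt_mul_mem t hq
  obtain ⟨M, hM⟩ := (isCompact_univ (X := UnitAddTorus (Fin n))).exists_bound_of_continuousOn
    hcont.continuousOn
  refine ⟨M + 1, ?_⟩
  have h := (isCompact_univ (X := UnitAddTorus (Fin n))).eventually_forall_of_forall_eventually
    (x₀ := q) (P := fun z t => ‖f (torusPt t * z)‖ ≤ M + 1) ?_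
  · simpa using h
  · intro t _
    have h1 : ContinuousAt f (torusPt t * q) := hf.continuousAt (hG.mem_nhds (hc.torusPt_mul_mem t hq))
    have h2 : ContinuousAt (fun p : (Fin n → ℂ) × UnitAddTorus (Fin n) => torusPt p.2 * p.1) (q, t) :=
      ((continuous_torusPt.comp continuous_snd).mul continuous_fst).continuousAt
    have h3 : ContinuousAt (fun p : (Fin n → ℂ) × UnitAddTorus (Fin n) => ‖f (torusPt p.2 * p.1)‖)
      (q, t) := (ContinuousAt.comp (f := fun p : (Fin n → ℂ) × UnitAddTorus (Fin n) =>
        torusPt p.2 * p.1) h1 h2).norm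
    filter_upwards [h3.eventually (gt_mem_nhds (lt_of_le_of_lt (hM t (mem_univ t)) (lt_add_one M)))]
      with p hp using hp.le

/-- The Laurent expansion of a holomorphic function on a circled domain, with its coefficients
determined by the components. -/
theorem exists_laurent (hG : IsDom G) (hc : IsCircled G)
    {f : (Fin n → ℂ) → ℂ} (hf : DifferentiableOn ℂ f G) :
    ∃ a : (Fin n → ℤ) → ℂ, (∀ α, a α ≠ 0 → G ⊆ monDomain α) ∧
      (∀ α, ∀ z ∈ G, component α f z = a α * mon α z) ∧
      (∀ q ∈ G, ∃ M : ℝ, ∀ᶠ z in 𝓝 q, ∀ α, ‖a α * mon α z‖ ≤ M) ∧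
      ∀ z ∈ G, HasSum (fun α => a α * mon α z) (f z) := by
  choose a ha1 ha2 using exists_component_eq hG hc hf
  have hbd : ∀ q ∈ G, ∃ M : ℝ, ∀ᶠ z in 𝓝 q, ∀ α, ‖a α * mon α z‖ ≤ M := by
    intro q hq
    obtain ⟨M, hM⟩ := eventually_forall_norm_le hG.1 hc hf.continuousOn hq
    refine ⟨M, ?_⟩
    filter_upwards [hM, hG.1.mem_nhds hq] with z hz hzG α
    rw [← ha2 α z hzG]
    exact norm_component_le α hz
  refine ⟨a, ha1, ha2, hbd, fun z hz => ?_⟩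
  have hsum := (summable_and_differentiableOn_tsum_mon hG.1 ha1 hbd).1 z hz
  let F : C(UnitAddTorus (Fin n), ℂ) := ⟨fun t => f (torusPt t * z),
    hf.continuousOn.comp_continuous (continuous_torusPt.mul continuous_const)
      fun t => hc.torusPt_mul_mem t hz⟩
  have hF : UnitAddTorus.mFourierCoeff F = fun α => a α * mon α z := by
    funext α
    exact ha2 α z hz
  have h := UnitAddTorus.hasSum_mFourier_series_apply_of_summable (f := F) (by rwa [hF]) 0
  rw [hF] at h
  simpa [F, ← mon_torusPt, torusPt_zero, mon] using h

/-! ### The inclusions between the function spaces -/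

theorem HInf_inter_HolClosure_subset_AInf (hG : IsOpen G) :
    HInf G ∩ HolClosure G ⊆ AInf G := by
  rintro f ⟨⟨hf, -⟩, U, hU, hGU, F, hF, hFf⟩
  refine mem_iInter.2 fun k => ⟨hf, fun ν _ => ⟨mderiv ν F, ?_, mderiv_eqOn hG ν hFf⟩⟩
  exact (differentiableOn_mderiv hU ν hF).continuousOn.mono hGU

theorem AInf_subset_SSpace : AInf G ⊆ SSpace G := by
  intro f hf
  rw [AInf, mem_iInter] at hf
  refine ⟨(hf 0).1, fun K hK hKG ν => ?_⟩
  obtain ⟨g, hg, hgf⟩ := (hf (∑ j, ν j)).2 ν le_rfl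
  obtain ⟨C, hC⟩ := hK.exists_bound_of_continuousOn (hg.mono hKG)
  exact ⟨C, fun z hz => hgf hz.2 ▸ hC z hz.1⟩

theorem IsDomainOfHolomorphy.mono {ℱ 𝒢 : Set ((Fin n → ℂ) → ℂ)} (h : IsDomainOfHolomorphy ℱ G)
    (hs : ℱ ⊆ 𝒢) : IsDomainOfHolomorphy 𝒢 G := by
  rintro ⟨G₀, G', h0, h1, h2, h3, h4⟩
  exact h ⟨G₀, G', h0, h1, h2, h3, fun f hf => h4 f (hs hf)⟩

/-! ### Derivatives of Laurent monomials -/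

theorem pderiv_mon (α : Fin n → ℤ) (c : ℂ) (j : Fin n) :
    EqOn (pderiv j fun z => c * mon α z)
      (fun z => c * α j * mon (α - Pi.single j 1) z) (offAxes n) := by
  intro z hz
  have hd : DifferentiableAt ℂ (fun z => c * mon α z) (z + Pi.single j 0) := by
    rw [Pi.single_zero, add_zero]
    exact ((differentiableOn_mon α).differentiableAt
      ((isOpen_monDomain α).mem_nhds fun i _ => hz i)).const_mul c
  have h1 := hd.hasFDerivAt.comp_hasDerivAt (0 : ℂ) (hasDerivAt_add_single z j 0)
  have e : ((fun z => c * mon α z) ∘ fun s : ℂ => z + Pi.single j s) =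
      fun s => c * ((z j + s) ^ α j * ∏ i ∈ Finset.univ.erase j, z i ^ α i) := by
    funext s
    simp only [Function.comp_apply, mon]
    rw [← Finset.mul_prod_erase _ _ (Finset.mem_univ j)]
    congr 2
    · simp
    · refine Finset.prod_congr rfl fun i hi => ?_
      simp [Finset.ne_of_mem_erase hi]
  have h2 : HasDerivAt (fun s : ℂ => (z j + s) ^ α j) (α j * z j ^ (α j - 1)) 0 := by
    have h3 := (hasDerivAt_zpow (α j) (z j + 0) (Or.inl (by simpa using hz j))).comp (0 : ℂ)
      ((hasDerivAt_id (0 : ℂ)).const_add (z j))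
    simp only [add_zero, mul_one] at h3
    exact h3
  rw [e] at h1
  have h4 := h1.unique ((h2.mul_const _).const_mul c)
  simp only [Pi.single_zero, add_zero] at h4
  change fderiv ℂ _ z _ = c * α j * mon (α - Pi.single j 1) z
  rw [h4, mon, ← Finset.mul_prod_erase _ _ (Finset.mem_univ j)]
  have : ∏ i ∈ Finset.univ.erase j, z i ^ (α - Pi.single j 1 : Fin n → ℤ) i =
      ∏ i ∈ Finset.univ.erase j, z i ^ α i :=
    Finset.prod_congr rfl fun i hi => by simp [Finset.ne_of_mem_erase hi]
  rw [this]
  simp only [Pi.sub_apply, Pi.single_eq_same]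
  ring

theorem iterate_pderiv_mon {f : (Fin n → ℂ) → ℂ} {α : Fin n → ℤ} {c : ℂ} (hc : c ≠ 0)
    (hf : EqOn f (fun z => c * mon α z) (offAxes n)) (j : Fin n) (k : ℕ)
    (hk : ∀ m < k, α j ≠ (m : ℤ)) :
    ∃ c' : ℂ, c' ≠ 0 ∧ EqOn ((pderiv j)^[k] f)
      (fun z => c' * mon (α - Pi.single j (k : ℤ)) z) (offAxes n) := by
  induction k with
  | zero => exact ⟨c, hc, by simpa using hf⟩
  | succ k ih =>
    obtain ⟨c', hc', h⟩ := ih fun m hm => hk m (by omega)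
    refine ⟨c' * ((α - Pi.single j (k : ℤ) : Fin n → ℤ) j : ℤ), mul_ne_zero hc' ?_, ?_⟩
    · have := hk k (by omega)
      simp only [Pi.sub_apply, Pi.single_eq_same]
      exact_mod_cast sub_ne_zero.2 this
    · rw [Function.iterate_succ_apply']
      refine (pderiv_eqOn (isOpen_offAxes n) j h).trans ((pderiv_mon _ _ j).trans ?_)
      rw [sub_sub, ← Pi.single_add]
      exact fun _ _ => by push_cast; rfl

/-- The derivative `∂^ν` of `c z^α` is a nonzero multiple of `z^(α-ν)` unless some `z_j^{α_j}` is
a polynomial of degree less than `ν_j`. -/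
theorem exists_mderiv_mon {α : Fin n → ℤ} {c : ℂ} (hc : c ≠ 0) (ν : Fin n → ℕ)
    (hν : ∀ j, ∀ m < ν j, α j ≠ (m : ℤ)) :
    ∃ c' : ℂ, c' ≠ 0 ∧ EqOn (mderiv ν fun z => c * mon α z)
      (fun z => c' * mon (α - fun j => (ν j : ℤ)) z) (offAxes n) := by
  have main : ∀ l : List (Fin n), l.Nodup → ∃ c' : ℂ, c' ≠ 0 ∧
      EqOn (l.foldr (fun j g => (pderiv j)^[ν j] g) fun z => c * mon α z)
        (fun z => c' * mon (α - (l.map fun j => Pi.single j (ν j : ℤ)).sum) z) (offAxes n) := by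
    intro l
    induction l with
    | nil => exact fun _ => ⟨c, hc, fun z _ => by simp⟩
    | cons j l ih =>
      intro hl
      obtain ⟨hj, hl⟩ := List.nodup_cons.1 hl
      obtain ⟨c', hc', h⟩ := ih hl
      have h0 : ∀ l : List (Fin n), j ∉ l →
          (l.map fun i => (Pi.single i (ν i : ℤ) : Fin n → ℤ)).sum j = 0 := by
        intro l
        induction l with
        | nil => simp
        | cons i l ih =>
          intro h
          rw [List.mem_cons, not_or] at h
          rw [List.map_cons, List.sum_cons, Pi.add_apply, ih h.2, Pi.single_eq_of_ne h.1, add_zero]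
      obtain ⟨c'', hc'', h'⟩ := iterate_pderiv_mon hc' h j (ν j) fun m hm => by
        rw [Pi.sub_apply, h0 l hj, sub_zero]
        exact hν j m hm
      refine ⟨c'', hc'', ?_⟩
      rw [List.foldr_cons, List.map_cons, List.sum_cons, add_comm, ← sub_sub]
      exact h'
  obtain ⟨c', hc', h⟩ := main _ (List.nodup_finRange n)
  refine ⟨c', hc', ?_⟩
  rw [← Fin.sum_univ_def, Finset.univ_sum_single] at h
  exact h

/-! ### The sets `G_ε` -/

theorem subset_GSet (ε : Fin n → Fin 2) : G ⊆ GSet ε G := fun z hz =>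
  ⟨fun _ => 1, fun _ => by simp, z, hz, by simp⟩

theorem isConnected_GSet (hG : IsConnected G) (ε : Fin n → Fin 2) : IsConnected (GSet ε G) := by
  have hB : IsConnected (closedBall (0 : Fin n → ℂ) 1) :=
    ⟨⟨0, mem_closedBall_self zero_le_one⟩, (convex_closedBall _ _).isPreconnected⟩
  convert (hB.prod hG).image (fun p : (Fin n → ℂ) × (Fin n → ℂ) => fun j => p.1 j ^ (ε j : ℕ) * p.2 j)
    (by fun_prop) using 1
  ext w
  simp only [GSet, mem_image, Prod.exists, mem_prod, mem_closedBall_zero_iff,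
    pi_norm_le_iff_of_nonneg zero_le_one]
  constructor
  · rintro ⟨l, hl, z, hz, rfl⟩
    exact ⟨l, z, ⟨hl, hz⟩, rfl⟩
  · rintro ⟨l, z, ⟨hl, hz⟩, rfl⟩
    exact ⟨l, hl, z, hz, rfl⟩

theorem mem_GSet_of_norm_le {ε : Fin n → Fin 2} {z w : Fin n → ℂ} (hz : z ∈ G)
    (h1 : ∀ j, ε j = 1 → ‖w j‖ ≤ ‖z j‖) (h0 : ∀ j, ε j = 0 → w j = z j) : w ∈ GSet ε G := by
  refine ⟨fun j => if ε j = 1 then w j / z j else 1, fun j => ?_, z, hz, funext fun j => ?_⟩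
  · by_cases h : ε j = 1
    · simpa [h] using div_le_one_of_le₀ (h1 j h) (norm_nonneg _)
    · simp [h]
  · by_cases h : ε j = 1
    · by_cases hzj : z j = 0
      · have := h1 j h
        rw [hzj, norm_zero] at this
        simp [hzj, norm_le_zero_iff.1 this]
      · simp [h, hzj]
    · simp [h, h0 j (by omega)]

/-- A point of `G_ε` is dominated, strictly in the coordinates with `ε_j = 1`, by a point of the
open set `G`. -/
theorem exists_mem_norm_lt_of_mem_GSet (hG : IsOpen G) {ε : Fin n → Fin 2} {q : Fin n → ℂ}
    (hq : q ∈ GSet ε G) :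
    ∃ z ∈ G, (∀ j, ε j = 1 → ‖q j‖ < ‖z j‖) ∧ ∀ j, ε j = 0 → q j = z j := by
  obtain ⟨l, hl, z, hz, rfl⟩ := hq
  let w : ℝ → Fin n → ℂ := fun δ j =>
    if ε j = 0 then z j else if z j = 0 then (δ : ℂ) else (1 + δ) * z j
  have hw0 : w 0 = z := by
    ext j
    by_cases h : z j = 0 <;> simp [w, h]
  have hw : ContinuousAt w 0 := by
    refine Continuous.continuousAt (continuous_pi fun j => ?_)
    by_cases h1 : ε j = 0 <;> by_cases h2 : z j = 0 <;> simp [w, h1, h2] <;> fun_prop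
  have h1 : ∀ᶠ δ : ℝ in 𝓝[>] 0, w δ ∈ G :=
    (hw.tendsto.mono_left nhdsWithin_le_nhds).eventually (by rw [hw0]; exact hG.mem_nhds hz)
  obtain ⟨δ, hδG, hδ⟩ := (h1.and self_mem_nhdsWithin).exists
  replace hδ : 0 < δ := hδ
  refine ⟨w δ, hδG, fun j hj => ?_, fun j hj => by simp [w, hj]⟩
  have hle : ‖l j ^ (ε j : ℕ) * z j‖ ≤ ‖z j‖ := by
    rw [norm_mul, norm_pow]
    exact mul_le_of_le_one_left (norm_nonneg _) (pow_le_one₀ (norm_nonneg _) (hl j))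
  refine hle.trans_lt ?_
  by_cases h2 : z j = 0
  · simp [w, hj, h2, hδ.ne']
  · have h3 : ‖(1 + δ : ℂ)‖ = 1 + δ := by
      rw [← Complex.ofReal_one, ← Complex.ofReal_add, Complex.norm_real,
        Real.norm_of_nonneg (by positivity)]
    have h4 : 0 < ‖z j‖ := norm_pos_iff.2 h2
    simp only [w, hj, h2, if_false, one_ne_zero, norm_mul, h3]
    nlinarith

theorem exists_mem_forall_eventually_of_mem_GSet (hG : IsOpen G) {ε : Fin n → Fin 2}
    {q : Fin n → ℂ} (hq : q ∈ GSet ε G) :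
    ∃ z ∈ G, ∀ N ∈ 𝓝 z, ∀ᶠ w in 𝓝 q, ∃ ζ ∈ N, (∀ j, ε j = 1 → ‖w j‖ ≤ ‖ζ j‖) ∧
      ∀ j, ε j = 0 → w j = ζ j := by
  obtain ⟨z, hz, h1, h0⟩ := exists_mem_norm_lt_of_mem_GSet hG hq
  refine ⟨z, hz, fun N hN => ?_⟩
  let ζ : (Fin n → ℂ) → Fin n → ℂ := fun w j => if ε j = 0 then w j else z j
  have hζq : ζ q = z := by
    ext j
    by_cases h : ε j = 0 <;> simp [ζ, h, h0]
  have hζ : Continuous ζ := by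
    refine continuous_pi fun j => ?_
    by_cases h : ε j = 0 <;> simp [ζ, h] <;> fun_prop
  have e1 : ∀ᶠ w in 𝓝 q, ζ w ∈ N := hζ.continuousAt.eventually (by rw [hζq]; exact hN)
  have e2 : ∀ᶠ w in 𝓝 q, ∀ j, ε j = 1 → ‖w j‖ ≤ ‖z j‖ := by
    refine eventually_all.2 fun j => ?_
    by_cases h : ε j = 1
    · filter_upwards [((continuous_apply j).norm.continuousAt (x := q)).eventually
        (gt_mem_nhds (h1 j h))] with w hw _ using hw.le
    · exact Eventually.of_forall fun w h' => absurd h' h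
  filter_upwards [e1, e2] with w hw1 hw2
  exact ⟨ζ w, hw1, fun j hj => by simpa [ζ, hj] using hw2 j hj, fun j hj => by simp [ζ, hj]⟩

theorem isOpen_GSet (hG : IsOpen G) (ε : Fin n → Fin 2) : IsOpen (GSet ε G) := by
  refine isOpen_iff_mem_nhds.2 fun q hq => ?_
  obtain ⟨z, hz, h⟩ := exists_mem_forall_eventually_of_mem_GSet hG hq
  filter_upwards [h G (hG.mem_nhds hz)] with w hw
  obtain ⟨ζ, hζ, h1, h0⟩ := hw
  exact mem_GSet_of_norm_le hζ h1 h0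

/-! ### Continuation of functions in `𝒮(G)` -/

/-- If `z₀ ∈ V_ε` lies in the closure of `G`, then the Laurent series of a function in `𝒮(G)`
contains no negative powers of the coordinates vanishing at `z₀`. Otherwise, differentiating away
the positive powers of these coordinates leaves a monomial that blows up at `z₀`. -/
theorem nonneg_of_mem_SSpace (hG : IsDom G) (hc : IsCircled G) {f : (Fin n → ℂ) → ℂ}
    (hf : f ∈ SSpace G) {ε : Fin n → Fin 2} {z₀ : Fin n → ℂ} (hz₀ : z₀ ∈ VSet ε)
    (hz₀G : z₀ ∈ closure G) {α : Fin n → ℤ} {a : ℂ} (ha : a ≠ 0)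
    (haf : ∀ z ∈ G, component α f z = a * mon α z) {j : Fin n} (hj : ε j = 1) : 0 ≤ α j := by
  by_contra! hneg
  let ν : Fin n → ℕ := fun i => if ε i = 1 then (α i).toNat else 0
  obtain ⟨c, hc0, hcν⟩ := exists_mderiv_mon (α := α) ha ν fun i m hm => by
    simp only [ν] at hm
    split_ifs at hm <;> omega
  obtain ⟨β, hβ⟩ := exists_mderiv_component hG.1 hc hf.1 α ν
  obtain ⟨C, hC⟩ := hf.2 (closedBall 0 (‖z₀‖ + 1) ∩ closure G)
    ((isCompact_closedBall _ _).inter_right isClosed_closure) inter_subset_right ν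
  set γ : Fin n → ℤ := α - fun i => (ν i : ℤ) with hγ
  have hbound : ∀ z ∈ G, z ∈ offAxes n → ‖z‖ ≤ ‖z₀‖ + 1 → ‖c * mon γ z‖ ≤ C := by
    intro z hzG hz0 hzn
    have h1 : mderiv ν (component α f) z = c * mon γ z :=
      (mderiv_eqOn hG.1 ν haf hzG).trans (hcν hz0)
    rw [← h1, hβ hzG]
    refine norm_component_le β fun t => hC _ ?_
    have hm := hc.torusPt_mul_mem t hzG
    refine ⟨⟨?_, subset_closure hm⟩, hm⟩
    rw [mem_closedBall_zero_iff]
    calc ‖torusPt t * z‖ ≤ ‖torusPt t‖ * ‖z‖ := norm_mul_le _ _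
      _ ≤ 1 * ‖z‖ := by gcongr; exact norm_torusPt_le t
      _ ≤ _ := by rwa [one_mul]
  have hdom : z₀ ∈ monDomain (-γ) := by
    intro i hi hzi
    have hεi : ε i = 1 := by
      by_contra h
      exact hz₀.2 i (by omega) hzi
    simp only [hγ, Pi.neg_apply, Pi.sub_apply, ν, hεi, if_true] at hi
    omega
  have hzero : mon (-γ) z₀ = 0 := by
    refine Finset.prod_eq_zero (Finset.mem_univ j) ?_
    rw [hz₀.1 j hj]
    refine zero_zpow _ ?_
    simp only [hγ, Pi.neg_apply, Pi.sub_apply, ν, hj, if_true]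
    omega
  have hcont : ContinuousAt (fun z => C * ‖mon (-γ) z‖) z₀ :=
    continuousAt_const.mul ((differentiableOn_mon (-γ)).continuousOn.continuousAt
      ((isOpen_monDomain _).mem_nhds hdom)).norm
  have hsmall : ∀ᶠ z in 𝓝 z₀, C * ‖mon (-γ) z‖ < ‖c‖ := by
    refine hcont.eventually (gt_mem_nhds ?_)
    simp only [hzero, norm_zero, mul_zero]
    exact norm_pos_iff.2 hc0
  have hnear : ∀ᶠ z in 𝓝 z₀, ‖z‖ ≤ ‖z₀‖ + 1 :=
    (continuous_norm.continuousAt.eventually (gt_mem_nhds (lt_add_one ‖z₀‖))).mono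
      fun _ h => le_of_lt h
  obtain ⟨N, hN, hNo, hzN⟩ := _root_.eventually_nhds_iff.1 (hsmall.and hnear)
  obtain ⟨y, hyN, hyG⟩ := mem_closure_iff.1 hz₀G N hNo hzN
  obtain ⟨z, ⟨hzN, hzG⟩, -, hz⟩ := exists_mem_forall_ne_zero
    ((hNo.inter hG.1).mem_nhds ⟨hyN, hyG⟩) ∅
  have hz' : z ∈ offAxes n := fun i => hz i (notMem_empty i)
  have h1 := hbound z hzG hz' (hN z hzN).2
  have h2 : ‖c‖ = ‖c * mon γ z‖ * ‖mon (-γ) z‖ := by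
    rw [← norm_mul, mul_assoc, mon_mul_mon_neg γ hz', mul_one]
  have h3 := (hN z hzN).1
  have h4 := mul_le_mul_of_nonneg_right h1 (norm_nonneg (mon (-γ) z))
  linarith

theorem exists_extension_GSet (hG : IsDom G) (hc : IsCircled G) {f : (Fin n → ℂ) → ℂ}
    (hf : f ∈ SSpace G) {ε : Fin n → Fin 2} (hε : (VSet ε ∩ frontier G).Nonempty) :
    ∃ F ∈ Hol (GSet ε G), EqOn F f G := by
  obtain ⟨z₀, hz₀, hz₀G⟩ := hε
  obtain ⟨a, ha, haf, hbd, hsum⟩ := exists_laurent hG hc hf.1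
  have hpos : ∀ α, a α ≠ 0 → ∀ j, ε j = 1 → 0 ≤ α j := fun α h j hj =>
    nonneg_of_mem_SSpace hG hc hf hz₀ (frontier_subset_closure hz₀G) h (haf α) hj
  refine ⟨fun z => ∑' α, a α * mon α z, (summable_and_differentiableOn_tsum_mon
    (isOpen_GSet hG.1 ε) ?_ ?_).2, fun z hz => (hsum z hz).tsum_eq⟩
  · rintro α h _ ⟨l, -, z, hz, rfl⟩ j hj
    have hεj : ε j = 0 := by
      by_contra h'
      have := hpos α h j (by omega)
      omega
    simpa [hεj] using ha α h hz j hj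
  · intro q hq
    obtain ⟨z, hz, h⟩ := exists_mem_forall_eventually_of_mem_GSet hG.1 hq
    obtain ⟨M, hM⟩ := hbd z hz
    refine ⟨M, ?_⟩
    filter_upwards [h _ hM] with w hw α
    obtain ⟨ζ, hζ, h1, h0⟩ := hw
    refine le_trans ?_ (hζ α)
    by_cases hα : a α = 0
    · simp [hα]
    rw [norm_mul, norm_mul, mon, mon, norm_prod, norm_prod]
    refine mul_le_mul_of_nonneg_left (Finset.prod_le_prod (fun _ _ => norm_nonneg _)
      fun j _ => ?_) (norm_nonneg _)
    by_cases hj : ε j = 0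
    · rw [h0 j hj]
    · have hj1 : ε j = 1 := by omega
      rw [norm_zpow, norm_zpow]
      exact zpow_le_zpow_left₀ (hpos α hα j hj1) (norm_nonneg _) (h1 j hj1)

/-! ### Continuation of bounded functions -/

/-- If `G` meets the hyperplane `z_j = 0` whenever some boundary point lies on it, as the condition
on `G_ε` ensures, then Laurent monomials without poles in `G` have no poles in its closure. -/
theorem closure_subset_monDomain (hG : IsDom G)
    (h : ∀ ε : Fin n → Fin 2, (VSet ε ∩ frontier G).Nonempty → GSet ε G ⊆ G)
    {α : Fin n → ℤ} (hα : G ⊆ monDomain α) : closure G ⊆ monDomain α := by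
  classical
  intro z hz j hj hzj
  by_cases hzG : z ∈ G
  · exact hα hzG j hj hzj
  let ε : Fin n → Fin 2 := fun i => if z i = 0 then 1 else 0
  have hzV : z ∈ VSet ε := by
    constructor <;> intro i hi <;> by_contra h' <;> simp [ε, h'] at hi
  have hsub := h ε ⟨z, hzV, by rw [hG.1.frontier_eq]; exact ⟨hz, hzG⟩⟩
  obtain ⟨g, hg⟩ := hG.2.1
  have hm : Function.update g j 0 ∈ GSet ε G := by
    refine mem_GSet_of_norm_le hg (fun i _ => ?_) fun i hi => ?_
    · by_cases hij : i = j
      · subst hij; simp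
      · simp [hij]
    · have hij : i ≠ j := by
        rintro rfl
        simp [ε, hzj] at hi
      simp [hij]
  exact hα (hsub hm) j hj (by simp)

theorem norm_mon_le_of_mem_closure {α : Fin n → ℤ} (hα : closure G ⊆ monDomain α) {C : ℝ}
    (hC : ∀ z ∈ G, ‖mon α z‖ ≤ C) : ∀ z ∈ closure G, ‖mon α z‖ ≤ C := by
  intro z hz
  have hcont : ContinuousAt (mon α) z := (differentiableOn_mon α).continuousOn.continuousAt
    ((isOpen_monDomain α).mem_nhds (hα hz))
  have := mem_closure_iff_nhdsWithin_neBot.1 hz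
  exact le_of_tendsto (hcont.norm.mono_left nhdsWithin_le_nhds)
    (eventually_nhdsWithin_of_forall hC)

/-- If `z^α` is bounded by `C` on `G` and has no poles in the closure, then this persists in every
`G'` to which all functions in `H^∞(G) ∩ 𝒪(closure G)` continue: consider the functions `z^α` and
`1 / (c - z^α)` with `|c| > C`. -/
theorem norm_mon_le_of_forall_extension {α : Fin n → ℤ} (hα : closure G ⊆ monDomain α) {C : ℝ}
    (hC : ∀ z ∈ G, ‖mon α z‖ ≤ C) {G₀ G' : Set (Fin n → ℂ)} (hG₀ : IsDom G₀) (hG' : IsDom G')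
    (hsub : G₀ ⊆ G ∩ G') (hext : ∀ f ∈ HInf G ∩ HolClosure G, ∃ F ∈ Hol G', EqOn F f G₀) :
    G' ⊆ monDomain α ∧ ∀ z ∈ G', ‖mon α z‖ ≤ C := by
  have hGα : G ⊆ monDomain α := subset_closure.trans hα
  have hidentity : ∀ {F H : (Fin n → ℂ) → ℂ}, DifferentiableOn ℂ F G' → DifferentiableOn ℂ H G' →
      EqOn F H G₀ → EqOn F H G' := fun hF hH h =>
    eqOn_of_eqOn_isOpen hG'.1 hG'.2.isPreconnected hG₀.1 hG₀.2.1
      (hsub.trans inter_subset_right) hF hH h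
  have hdom : G' ⊆ monDomain α := by
    obtain ⟨F, hF, hFeq⟩ := hext (mon α) ⟨⟨(differentiableOn_mon α).mono hGα, C, hC⟩,
      monDomain α, isOpen_monDomain α, hα, mon α, differentiableOn_mon α, fun _ _ => rfl⟩
    refine subset_monDomain_of_mul_eq hG'.1 one_ne_zero (h := F) ?_
    refine hidentity (F := fun z => F z * monNum (-α) z) (H := fun z => 1 * monNum α z)
      (hF.mul (differentiable_monNum _).differentiableOn)
      ((differentiable_monNum _).differentiableOn.const_mul _) fun z hz => ?_
    simp only
    rw [hFeq hz, mon_mul_monNum_neg α (hGα (hsub hz).1), one_mul]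
  refine ⟨hdom, fun z₁ hz₁ => ?_⟩
  by_contra! hlt
  set c := mon α z₁ with hc
  set f : (Fin n → ℂ) → ℂ := fun z => (c - mon α z)⁻¹ with hf
  have hne : ∀ z, ‖mon α z‖ ≤ C → c - mon α z ≠ 0 := by
    intro z hz h0
    rw [sub_eq_zero.1 h0] at hlt
    linarith
  set U : Set (Fin n → ℂ) := monDomain α ∩ (fun z => c - mon α z) ⁻¹' {0}ᶜ with hU
  have hUo : IsOpen U := (continuousOn_const.sub (differentiableOn_mon α).continuousOn
    ).isOpen_inter_preimage (isOpen_monDomain α) isOpen_compl_singleton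
  have hclU : closure G ⊆ U := fun z hz =>
    ⟨hα hz, hne z (norm_mon_le_of_mem_closure hα hC z hz)⟩
  have hfU : DifferentiableOn ℂ f U :=
    (((differentiableOn_mon α).mono inter_subset_left).const_sub c).inv fun z hz => hz.2
  have hfB : ∀ z ∈ G, ‖f z‖ ≤ (‖c‖ - C)⁻¹ := by
    intro z hz
    rw [hf, norm_inv]
    refine inv_anti₀ (by linarith) ?_
    linarith [norm_sub_norm_le c (mon α z), hC z hz]
  obtain ⟨F, hF, hFeq⟩ := hext f ⟨⟨hfU.mono (subset_closure.trans hclU), _, hfB⟩,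
    U, hUo, hclU, f, hfU, fun _ _ => rfl⟩
  have h1 := hidentity (F := fun z => F z * (c - mon α z)) (H := fun _ => 1)
    (hF.mul (((differentiableOn_mon α).mono hdom).const_sub c)) (differentiableOn_const _)
    (fun z hz => by
      simp only
      rw [hFeq hz, hf]
      exact inv_mul_cancel₀ (hne z (hC z (hsub hz).1))) hz₁
  simp [← hc] at h1

/-- All bounded holomorphic functions on `G` continue to `G'` as soon as those which are
holomorphic on the closure do, because the terms of the Laurent series do, with the same bounds. -/
theorem exists_extension_of_mem_HInf (hG : IsDom G) (hcirc : IsCircled G)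
    (h : ∀ ε : Fin n → Fin 2, (VSet ε ∩ frontier G).Nonempty → GSet ε G ⊆ G)
    {G₀ G' : Set (Fin n → ℂ)} (hG₀ : IsDom G₀) (hG' : IsDom G') (hsub : G₀ ⊆ G ∩ G')
    (hext : ∀ f ∈ HInf G ∩ HolClosure G, ∃ F ∈ Hol G', EqOn F f G₀) {f : (Fin n → ℂ) → ℂ}
    (hf : f ∈ HInf G) : ∃ F ∈ Hol G', EqOn F f G₀ := by
  obtain ⟨hfd, M, hM⟩ := hf
  obtain ⟨a, ha, haf, -, hsum⟩ := exists_laurent hG hcirc hfd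
  have key : ∀ α, a α ≠ 0 → G' ⊆ monDomain α ∧ ∀ z ∈ G', ‖mon α z‖ ≤ M / ‖a α‖ := by
    intro α hα
    refine norm_mon_le_of_forall_extension (closure_subset_monDomain hG h (ha α hα))
      (fun z hz => ?_) hG₀ hG' hsub hext
    rw [le_div_iff₀' (norm_pos_iff.2 hα), ← norm_mul, ← haf α z hz]
    exact norm_component_le α fun t => hM _ (hcirc.torusPt_mul_mem t hz)
  refine ⟨fun z => ∑' α, a α * mon α z, (summable_and_differentiableOn_tsum_mon hG'.1
    (fun α hα => (key α hα).1) fun q _ => ⟨M, ?_⟩).2, fun z hz => (hsum z (hsub hz).1).tsum_eq⟩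
  filter_upwards [hG'.1.mem_nhds ‹q ∈ G'›] with z hz α
  by_cases hα : a α = 0
  -- `0 ≤ M`, because `M` bounds `|f|` on the nonempty set `G`
  · obtain ⟨g, hg⟩ := hG.2.1
    simpa [hα] using (norm_nonneg _).trans (hM g hg)
  · rw [norm_mul, ← le_div_iff₀' (norm_pos_iff.2 hα)]
    exact (key α hα).2 z hz

end Circled

theorem proposition5 (n : ℕ) (G : Set (Fin n → ℂ)) (hG : Circled.IsDom G)
    (hcirc : Circled.IsCircled G)
    (hH : Circled.IsDomainOfHolomorphy (Circled.HInf G) G) :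
    List.TFAE [
      ∀ ε : Fin n → Fin 2,
        (Circled.VSet ε ∩ frontier G).Nonempty → Circled.GSet ε G ⊆ G,
      Circled.IsDomainOfHolomorphy (Circled.SSpace G) G,
      Circled.IsDomainOfHolomorphy (Circled.AInf G) G,
      Circled.IsDomainOfHolomorphy (Circled.HInf G ∩ Circled.HolClosure G) G] := by
  tfae_have 1 → 4 := by
    rintro h ⟨G₀, G', hG₀, hG', hsub, hne, hext⟩
    exact hH ⟨G₀, G', hG₀, hG', hsub, hne, fun f hf =>
      Circled.exists_extension_of_mem_HInf hG hcirc h hG₀ hG' hsub hext hf⟩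
  tfae_have 4 → 3 := fun h => h.mono (Circled.HInf_inter_HolClosure_subset_AInf hG.1)
  tfae_have 3 → 2 := fun h => h.mono Circled.AInf_subset_SSpace
  tfae_have 2 → 1 := by
    intro h ε hε
    by_contra hne
    exact h ⟨G, Circled.GSet ε G, hG,
      ⟨Circled.isOpen_GSet hG.1 ε, Circled.isConnected_GSet hG.2 ε⟩,
      fun z hz => ⟨hz, Circled.subset_GSet ε hz⟩, hne, fun f hf =>
      Circled.exists_extension_GSet hG hcirc hf hε⟩
  tfae_finish
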